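/- Let the cake be $[0,1]$. A piece of cake is a finite union of subintervals of $[0,1]$ (each open, closed or half-open). There are $n\ge 1$ agents; agent $i$ is single-minded with a demand set $D_i\subseteq[0,1]$ that is a finite union of closed intervals $[l,r]$ with $0\le l<r\le 1$, and its utility for $S\subseteq[0,1]$ is $V_i(S)=1$ if $D_i\subseteq S$ and $V_i(S)=0$ otherwise. A price density is a nonnegative function $p$ that is integrable on $[0,1]$; the price of a measurable set $S\subseteq[0,1]$ is $p(S)=\int_S p(t)\,dt$. A competitive allocation from equal incomes (CAEI) is a price density $p$ together with pairwise disjoint pieces of cake $x_1,\dots,x_n$ such that $\bigcup_{i=1}^n x_i=[0,1]$ and, for every agent $i$, $p(x_i)\le 1$ and $V_i(S)\le V_i(x_i)$ for all measurable $S\subseteq[0,1]$ with $p(S)\le 1$. Theorem. (a) Every such cake cutting instance, with arbitrary real interval endpoints, has a CAEI. (b) A CAEI can be computed in polynomial time: there is a deterministic Turing machine which, given an instance whose interval endpoints are rational (the list, over the agents, of the lists of the intervals that make up $D_i$, with endpoints written as fractions of natural numbers in binary), outputs in a number of steps polynomial in the length of the input a CAEI for that instance, in the following form: for every agent $i$,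 a finite list of intervals with rational endpoints whose union is $x_i$, each with a rational price per unit length; here $p$ is the step function with these values on these intervals. -/

import Mathlib

open Set MeasureTheory

namespace CakeCutting

/-! ### The model: cake, pieces, single-minded agents, CAEI -/

/-- The cake is the unit interval. -/
def cake : Set ℝ := Icc 0 1

/-- A piece of cake is a finite union of subintervals of the cake (open, closed or half-open). -/
def IsPiece (A : Set ℝ) : Prop :=
  A ⊆ cake ∧ ∃ F : Set (Set ℝ), F.Finite ∧ (∀ J ∈ F, J.OrdConnected) ∧ A = ⋃₀ F

/-- A demand set is a finite union of nondegenerate closed subintervals `[l, r]` of the cake. -/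
def IsDemand (D : Set ℝ) : Prop :=
  ∃ F : Set (ℝ × ℝ), F.Finite ∧ (∀ J ∈ F, 0 ≤ J.1 ∧ J.1 < J.2 ∧ J.2 ≤ 1) ∧
    D = ⋃ J ∈ F, Icc J.1 J.2

open scoped Classical in
/-- The utility of a single-minded agent with demand set `D` for the bundle `A`. -/
noncomputable def utility (D A : Set ℝ) : ℝ := if D ⊆ A then 1 else 0

/-- The price of the bundle `S` under the price density `p`. -/
noncomputable def bundlePrice (p : ℝ → ℝ) (S : Set ℝ) : ℝ := ∫ t in S, p t

/-- A price density is a nonnegative integrable function on the cake. -/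
structure IsPriceDensity (p : ℝ → ℝ) : Prop where
  nonneg : ∀ t ∈ cake, 0 ≤ p t
  integrable : IntegrableOn p cake

/-- An allocation is a partition of the cake into pieces, one (possibly empty) for each agent. -/
structure IsAllocation {n : ℕ} (x : Fin n → Set ℝ) : Prop where
  piece : ∀ i, IsPiece (x i)
  disjoint : ∀ i j, i ≠ j → Disjoint (x i) (x j)
  cover : ⋃ i, x i = cake

/-- `(p, x)` is a competitive allocation from equal incomes for single-minded agents with
demand sets `D`: `x` allocates the whole cake, no agent spends more than its unit budget, and
every agent's bundle is utility-maximizing among the bundles that cost at most one unit. -/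
structure IsCAEI {n : ℕ} (D : Fin n → Set ℝ) (p : ℝ → ℝ) (x : Fin n → Set ℝ) : Prop where
  allocation : IsAllocation x
  density : IsPriceDensity p
  affordable : ∀ i, bundlePrice p (x i) ≤ 1
  optimal : ∀ i, ∀ S : Set ℝ, S ⊆ cake → MeasurableSet S → bundlePrice p S ≤ 1 →
    utility (D i) S ≤ utility (D i) (x i)

/-! ### Finite descriptions of instances and of solutions -/

/-- A nonnegative rational number, written as a fraction (not necessarily in lowest terms). -/
structure Frac where
  num : ℕ
  den : ℕ
  den_pos : 0 < den

/-- The real number that the fraction denotes. -/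
noncomputable def Frac.val (q : Frac) : ℝ := (q.num : ℝ) / (q.den : ℝ)

/-- An instance with rational data: at least one agent and, for each agent, the list of the
endpoints `(l, r)`, with `0 ≤ l < r ≤ 1`, of the intervals whose union is the agent's demand set. -/
structure Instance where
  demands : List (List (Frac × Frac))
  ne_nil : demands ≠ []
  valid : ∀ L ∈ demands, ∀ J ∈ L, J.1.val < J.2.val ∧ J.2.val ≤ 1

/-- The number of agents. -/
def Instance.agents (I : Instance) : ℕ := I.demands.length

/-- The demand sets of the agents. -/
def Instance.demand (I : Instance) (i : Fin I.agents) : Set ℝ :=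
  ⋃ J ∈ I.demands.get i, Icc (J.1.val) (J.2.val)

/-- An interval with rational endpoints, each of which may or may not belong to it, together with
a rational price per unit of length on it. -/
structure PricedInterval where
  left : Frac
  right : Frac
  leftClosed : Bool
  rightClosed : Bool
  density : Frac

/-- The set of points of a priced interval. -/
def PricedInterval.toSet (P : PricedInterval) : Set ℝ :=
  {t | (P.left.val < t ∨ (P.leftClosed = true ∧ t = P.left.val)) ∧
       (t < P.right.val ∨ (P.rightClosed = true ∧ t = P.right.val))}

/-- A description of an allocation and a price density: for each agent, the list of the
priced intervals that the agent receives. -/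
abbrev Output : Type := List (List PricedInterval)

/-- The bundle of agent `i` is the union of the intervals in the `i`-th list. -/
def Output.bundle (O : Output) (n : ℕ) (i : Fin n) : Set ℝ :=
  ⋃ P ∈ O.getD i.val [], P.toSet

/-- The step function that has the prescribed density on each of the listed intervals. -/
noncomputable def Output.price (O : Output) (t : ℝ) : ℝ :=
  (O.flatten.map fun P => P.toSet.indicator (fun _ => P.density.val) t).sum

/-! ### Encodings as words over a finite alphabet -/

/-- The alphabet: the two binary digits, a marker for a list item, and an end marker. -/
inductive Sym where
  | bit (b : Bool)
  | item
  | close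
deriving DecidableEq, Fintype

/-- Natural numbers are written in binary, least significant digit first. -/
def encodeNat (k : ℕ) : List Sym := k.bits.map Sym.bit ++ [Sym.close]

def encodeFrac (q : Frac) : List Sym := encodeNat q.num ++ encodeNat q.den

def encodeList {α : Type} (enc : α → List Sym) (L : List α) : List Sym :=
  (L.flatMap fun a => Sym.item :: enc a) ++ [Sym.close]

def encodeInterval (J : Frac × Frac) : List Sym := encodeFrac J.1 ++ encodeFrac J.2

def encodePricedInterval (P : PricedInterval) : List Sym :=
  encodeFrac P.left ++ encodeFrac P.right ++ [Sym.bit P.leftClosed, Sym.bit P.rightClosed] ++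
    encodeFrac P.density

def encodeInstance (I : Instance) : List Sym := encodeList (encodeList encodeInterval) I.demands

def encodeOutput (O : Output) : List Sym := encodeList (encodeList encodePricedInterval) O

end CakeCutting

/-!
A competitive allocation can always be found in which the first agent gets almost everything.
For every other agent with a nonempty demand set, let `q` be the left endpoint of the first interval
of its demand. Let `δ > 0` be smaller than the distance of any two distinct interval endpoints of
the instance. For each such point `q`, the atom `(q, q + δ)` gets the price density `1 / δ`, hence
the price `1`, and goes to one of the agents with this point. The rest of the cake goes to the first
agent and has a positive density that is so small that it costs at most `1`.

* The demand of an agent other than the first one is empty or contains some `[q, r]` with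
  `r > q + δ`, that is, an atom and a stretch of positive price. Such a demand costs more than `1`,
  so that the agent cannot do better than with what it gets.
* A demand interval `[l, r]` of the first agent that meets the atom at `q` has `l ≤ q` and
  `q + δ < r` by the choice of `δ`. So the demand of the first agent costs more than `1`, too,
  unless it is disjoint from all atoms; and then the first agent gets it.

This is `isCAEI_of_atoms`, and `exists_isCAEI` follows.

For rational data, `δ = 4 ^ (-m)` will do, where `m` is the length of the input: the denominators
are less than `2 ^ m`, and distinct fractions `a / b` and `c / d` differ by at least `1 / (b * d)`. The
points need not be sorted, since the gap after an atom ends at the least larger point, or at `1`.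
So `solution` needs only a few nested passes over lists, additions, multiplications and comparisons.
It is shown to be a solution in `isCAEI_solution`.

The running time is controlled as follows. Programs (`Prog`) are built from stack operations, tests
and loops, have a semantics with a cost (`Exec`), and are compiled to multi-stack Turing machines
that run for the same time (`Exec.leads`). All data are binary trees, stored on a stack in prefix
code, where the word of a tree determines its end, so that the topmost tree can be removed, copied,
or exchanged with the next one, with the help of a counter. The class `FP` consists of the functions for
which a program replaces the topmost tree, the argument, by the value in polynomial time. It is
closed under composition, pairing, case distinctions, and under folds over lists whose steps add to
the size of the accumulator at most an amount that does not depend on the accumulator (`FP.foldl`).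
These closure properties give binary arithmetic and the algorithm.
-/

namespace CakeCutting

open Turing Function

/-! ### Structured stack programs and their compilation to Turing machines -/

/-- The five stacks of a program: a main stack for data, a counter, and three scratch stacks. -/
inductive Stk where
  | main | cnt | a | b | c
deriving DecidableEq

instance : Fintype Stk := ⟨{.main, .cnt, .a, .b, .c}, fun k => by cases k <;> decide⟩

/-- The contents of all stacks; the top of a stack is the head of its list. -/
abbrev Mem : Type := Stk → List Sym

/-- Structured programs over the stacks. Tests may only look at the top of a single stack. -/
inductive Prog where
  | skip
  /-- Push a fixed symbol. -/
  | push (k : Stk) (s : Sym)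
  /-- Pop a symbol from a stack and push it on each of the listed stacks. -/
  | move (k : Stk) (ks : List Stk)
  | seq (p q : Prog)
  | ite (k : Stk) (test : Option Sym → Bool) (p q : Prog)
  | loop (k : Stk) (test : Option Sym → Bool) (p : Prog)

/-- Push a symbol on several stacks. -/
def Mem.pushAll (s : Sym) : List Stk → Mem → Mem
  | [], S => S
  | k :: ks, S => pushAll s ks (update S k (s :: S k))

/-- `Exec p S S' t`: the program `p`, started on the stacks `S`, ends with the stacks `S'`
within time `t`. -/
inductive Exec : Prog → Mem → Mem → ℕ → Prop
  | skip (S) : Exec .skip S S 1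
  | push (k s S) : Exec (.push k s) S (update S k (s :: S k)) 1
  | move (k ks S s r) (h : S k = s :: r) :
      Exec (.move k ks) S (Mem.pushAll s ks (update S k r)) 1
  | seq {p q S S' S'' t t'} : Exec p S S' t → Exec q S' S'' t' → Exec (.seq p q) S S'' (t + t')
  | ite_true {k test p q S S' t} : test (S k).head? = true → Exec p S S' t →
      Exec (.ite k test p q) S S' (t + 1)
  | ite_false {k test p q S S' t} : test (S k).head? = false → Exec q S S' t →
      Exec (.ite k test p q) S S' (t + 1)
  | loop_true {k test p S S' S'' t t'} : test (S k).head? = true → Exec p S S' t →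
      Exec (.loop k test p) S' S'' t' → Exec (.loop k test p) S S'' (t + t' + 1)
  | loop_false {k test p S} : test (S k).head? = false → Exec (.loop k test p) S S 1
  | weaken {p S S' t t'} : Exec p S S' t → t ≤ t' → Exec p S S' t'

/-- The control points of a program. -/
def Prog.Label : Prog → Type
  | .skip => Unit
  | .push _ _ => Unit
  | .move _ _ => Unit
  | .seq p q => p.Label ⊕ q.Label
  | .ite _ _ p q => Option (p.Label ⊕ q.Label)
  | .loop _ _ p => Option p.Label

instance Prog.fintypeLabel : (p : Prog) → Fintype p.Label
  | .skip => inferInstanceAs (Fintype Unit)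
  | .push _ _ => inferInstanceAs (Fintype Unit)
  | .move _ _ => inferInstanceAs (Fintype Unit)
  | .seq p q =>
    have := fintypeLabel p
    have := fintypeLabel q
    inferInstanceAs (Fintype (p.Label ⊕ q.Label))
  | .ite _ _ p q =>
    have := fintypeLabel p
    have := fintypeLabel q
    inferInstanceAs (Fintype (Option (p.Label ⊕ q.Label)))
  | .loop _ _ p =>
    have := fintypeLabel p
    inferInstanceAs (Fintype (Option p.Label))

/-- The control point at which the execution of a program starts. -/
def Prog.entry : (p : Prog) → p.Label
  | .skip => ()
  | .push _ _ => ()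
  | .move _ _ => ()
  | .seq p _ => Sum.inl p.entry
  | .ite _ _ _ _ => (none : Option _)
  | .loop _ _ _ => (none : Option _)

/-- Statements of the target machines: all stacks are over `Sym`, and the internal state remembers
the symbol that was read last. -/
abbrev TStmt (Λ : Type) : Type := TM2.Stmt (fun _ : Stk => Sym) Λ (Option Sym)

/-- Push the remembered symbol on several stacks, then continue with `q`. -/
def pushAllStmt {Λ : Type} (q : TStmt Λ) : List Stk → TStmt Λ
  | [] => q
  | k :: ks => .push k (fun v => v.getD .close) (pushAllStmt q ks)

/-- The statement at each control point of a program that is part of a larger machine with labels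
`Λ`, into which the control points are embedded by `emb`; `next` is the label that gets the control
when the program is finished. -/
def Prog.code {Λ : Type} : (p : Prog) → (p.Label → Λ) → Λ → p.Label → TStmt Λ
  | .skip, _, next, _ => .goto fun _ => next
  | .push k s, _, next, _ => .push k (fun _ => s) (.goto fun _ => next)
  | .move k ks, _, next, _ => .pop k (fun _ s => s) (pushAllStmt (.goto fun _ => next) ks)
  | .seq p q, emb, next, l => match l with
    | Sum.inl l => p.code (fun l => emb (Sum.inl l)) (emb (Sum.inr q.entry)) l
    | Sum.inr l => q.code (fun l => emb (Sum.inr l)) next l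
  | .ite k test p q, emb, next, l => match l with
    | none => .peek k (fun _ s => s) (.branch test
        (.goto fun _ => emb (some (Sum.inl p.entry))) (.goto fun _ => emb (some (Sum.inr q.entry))))
    | some (Sum.inl l) => p.code (fun l => emb (some (Sum.inl l))) next l
    | some (Sum.inr l) => q.code (fun l => emb (some (Sum.inr l))) next l
  | .loop k test p, emb, next, l => match l with
    | none => .peek k (fun _ s => s) (.branch test
        (.goto fun _ => emb (some p.entry)) (.goto fun _ => next))
    | some l => p.code (fun l => emb (some l)) (emb none) l

/-- `Leads m x y t`: the machine with the statements `m` gets from `x` to `y` in at most `t` steps,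
where the internal state is disregarded. -/
def Leads {Λ : Type} (m : Λ → TStmt Λ) (x y : Λ × Mem) (t : ℕ) : Prop :=
  ∀ v : Option Sym, ∃ v' : Option Sym, ∃ s ≤ t, (flip bind (TM2.step m))^[s]
    (some (⟨some x.1, v, x.2⟩ : TM2.Cfg (fun _ : Stk => Sym) Λ (Option Sym))) =
      some ⟨some y.1, v', y.2⟩

theorem Leads.trans {Λ : Type} {m : Λ → TStmt Λ} {x y z : Λ × Mem} {t t' : ℕ}
    (h : Leads m x y t) (h' : Leads m y z t') : Leads m x z (t + t') := by
  intro v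
  obtain ⟨v₁, s, hs, e⟩ := h v
  obtain ⟨v₂, s', hs', e'⟩ := h' v₁
  refine ⟨v₂, s' + s, by omega, ?_⟩
  rw [iterate_add_apply, e, e']

theorem Leads.mono {Λ : Type} {m : Λ → TStmt Λ} {x y : Λ × Mem} {t t' : ℕ}
    (h : Leads m x y t) (ht : t ≤ t') : Leads m x y t' := fun v =>
  let ⟨v', s, hs, e⟩ := h v
  ⟨v', s, hs.trans ht, e⟩

theorem Leads.of_step {Λ : Type} {m : Λ → TStmt Λ} {x y : Λ × Mem}
    (h : ∀ v, ∃ v', TM2.stepAux (m x.1) v x.2 = ⟨some y.1, v', y.2⟩) : Leads m x y 1 := by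
  intro v
  obtain ⟨v', e⟩ := h v
  exact ⟨v', 1, le_rfl, congrArg some e⟩

theorem stepAux_pushAllStmt {Λ : Type} (q : TStmt Λ) (s : Sym) (ks : List Stk) (S : Mem) :
    TM2.stepAux (pushAllStmt q ks) (some s) S = TM2.stepAux q (some s) (Mem.pushAll s ks S) := by
  induction ks generalizing S with
  | nil => rfl
  | cons k ks ih => simp [pushAllStmt, Mem.pushAll, ih]

/-- The compiled code of a program does what the program does, in the same time. -/
theorem Exec.leads {p : Prog} {S S' : Mem} {t : ℕ} (h : Exec p S S' t) {Λ : Type}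
    (m : Λ → TStmt Λ) (emb : p.Label → Λ) (next : Λ) (hm : ∀ l, m (emb l) = p.code emb next l) :
    Leads m (emb p.entry, S) (next, S') t := by
  induction h generalizing next with
  | skip S => exact .of_step fun v => ⟨v, by rw [hm]; rfl⟩
  | push k s S => exact .of_step fun v => ⟨v, by rw [hm]; rfl⟩
  | move k ks S s r h =>
    refine .of_step fun v => ⟨some s, ?_⟩
    rw [hm]
    simp [Prog.code, h, stepAux_pushAllStmt]
  | @seq p q _ _ _ _ _ _ _ ih ih' =>
    exact (ih (fun l => emb (Sum.inl l)) (emb (Sum.inr q.entry)) fun l => hm _).trans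
      (ih' (fun l => emb (Sum.inr l)) next fun l => hm _)
  | @ite_true k test p q S S' t h _ ih =>
    rw [add_comm]
    refine Leads.trans (y := (emb (some (Sum.inl p.entry)), S))
      (.of_step fun _ => ⟨(S k).head?, ?_⟩) (ih (fun l => emb (some (Sum.inl l))) next fun l => hm _)
    rw [hm]
    simp only [Prog.entry, Prog.code, TM2.stepAux, h, cond]
  | @ite_false k test p q S S' t h _ ih =>
    rw [add_comm]
    refine Leads.trans (y := (emb (some (Sum.inr q.entry)), S))
      (.of_step fun _ => ⟨(S k).head?, ?_⟩) (ih (fun l => emb (some (Sum.inr l))) next fun l => hm _)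
    rw [hm]
    simp only [Prog.entry, Prog.code, TM2.stepAux, h, cond]
  | @loop_true k test p S S' S'' t t' h _ _ ih ih' =>
    rw [add_comm]
    refine Leads.trans (y := (emb (some p.entry), S)) (.of_step fun _ => ⟨(S k).head?, ?_⟩)
      ((ih (fun l => emb (some l)) (emb none) fun l => hm _).trans (ih' emb next hm))
    rw [hm]
    simp only [Prog.entry, Prog.code, TM2.stepAux, h, cond]
  | @loop_false k test p S h =>
    refine .of_step fun _ => ⟨(S k).head?, ?_⟩
    rw [hm]
    simp only [Prog.entry, Prog.code, TM2.stepAux, h, cond]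
  | weaken _ ht ih => exact (ih emb next hm).mono ht

/-- The stacks with the given contents. -/
def Mem.mk (m n x y z : List Sym) : Mem
  | .main => m
  | .cnt => n
  | .a => x
  | .b => y
  | .c => z

/-- The Turing machine of a program. It reads its input from the stack `a`, where it also leaves
its output. -/
def Prog.machine (p : Prog) : FinTM2 where
  K := Stk
  k₀ := .a
  k₁ := .a
  Γ _ := Sym
  Λ := Option p.Label
  main := some p.entry
  σ := Option Sym
  initialState := none
  Γk₀Fin := inferInstanceAs (Fintype Sym)
  m
    | none => .load (fun _ => none) .halt
    | some l => p.code some none l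

theorem Prog.machine_outputs (p : Prog) (w w' : List Sym) (t : ℕ)
    (h : Exec p (Mem.mk [] [] w [] []) (Mem.mk [] [] w' [] []) t) :
    Nonempty (TM2OutputsInTime p.machine w (some w') (t + 1)) := by
  obtain ⟨v, s, hs, e⟩ := h.leads p.machine.m some none (fun _ => rfl) none
  have hi : initList p.machine w = ⟨some (some p.entry), none, Mem.mk [] [] w [] []⟩ := by
    unfold initList
    congr 1
    funext k
    cases k <;> rfl
  have hf : haltList p.machine w' = ⟨none, none, Mem.mk [] [] w' [] []⟩ := by
    unfold haltList
    congr 1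
    funext k
    cases k <;> rfl
  refine ⟨⟨⟨1 + s, ?_⟩, (by omega : 1 + s ≤ t + 1)⟩⟩
  rw [iterate_add_apply, hi]
  exact (congrArg _ e).trans (congrArg some hf.symm)

/-- A function on words that a program computes in polynomial time is computable in polynomial time
by a Turing machine, in any encodings that turn the function into the one on words. -/
theorem Prog.computableInPolyTime {α β : Type} (ea : α → List Sym) (eb : β → List Sym) (f : α → β)
    (p : Prog) (k : ℕ)
    (h : ∀ x, Exec p (Mem.mk [] [] (ea x) [] []) (Mem.mk [] [] (eb (f x)) [] [])
      (((ea x).length + 2) ^ k)) :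
    Nonempty (TM2ComputableInPolyTime ea eb f) := by
  refine ⟨{ tm := p.machine, inputAlphabet := Equiv.refl _, outputAlphabet := Equiv.refl _
            time := (Polynomial.X + 2) ^ k + 1, outputsFun := fun x => ?_ }⟩
  have hid : ∀ w : List Sym, List.map (Equiv.refl Sym).invFun w = w := List.map_id
  have out : ∀ w w' : List Sym, w = ea x → w' = eb (f x) →
      TM2OutputsInTime p.machine w (some w') (((ea x).length + 2) ^ k + 1) := by
    rintro _ _ rfl rfl
    exact (p.machine_outputs _ _ _ (h x)).some
  have e : ((Polynomial.X + 2 : Polynomial ℕ) ^ k + 1).eval (ea x).length =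
      ((ea x).length + 2) ^ k + 1 := by simp
  rw [e]
  exact out _ _ (hid _) (hid _)

/-! ### Binary trees on a stack -/

/-- Binary trees, the universal data type of the programs below. -/
inductive BinTree where
  | leaf
  | node (l r : BinTree)

/-- The prefix code of a tree. -/
def BinTree.word : BinTree → List Sym
  | .leaf => [.close]
  | .node l r => .item :: (l.word ++ r.word)

/-- The length of the prefix code of a tree. -/
def BinTree.size (t : BinTree) : ℕ := t.word.length

@[simp] theorem BinTree.size_leaf : BinTree.leaf.size = 1 := rfl

@[simp] theorem BinTree.size_node (l r : BinTree) : (BinTree.node l r).size =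
    l.size + r.size + 1 := by
  simp [size, word]

theorem BinTree.length_word (t : BinTree) : t.word.length = t.size := rfl

section Mem

variable (m n x y z w : List Sym)

@[simp] theorem Mem.update_main : update (Mem.mk m n x y z) .main w = Mem.mk w n x y z := by
  funext k; cases k <;> rfl

@[simp] theorem Mem.update_a : update (Mem.mk m n x y z) .a w = Mem.mk m n w y z := by
  funext k; cases k <;> rfl

@[simp] theorem Mem.update_b : update (Mem.mk m n x y z) .b w = Mem.mk m n x w z := by
  funext k; cases k <;> rfl

@[simp] theorem Mem.update_c : update (Mem.mk m n x y z) .c w = Mem.mk m n x y w := by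
  funext k; cases k <;> rfl

@[simp] theorem Mem.mk_main : Mem.mk m n x y z .main = m := rfl
@[simp] theorem Mem.mk_cnt : Mem.mk m n x y z .cnt = n := rfl
@[simp] theorem Mem.mk_a : Mem.mk m n x y z .a = x := rfl
@[simp] theorem Mem.mk_b : Mem.mk m n x y z .b = y := rfl
@[simp] theorem Mem.mk_c : Mem.mk m n x y z .c = z := rfl

end Mem

theorem Exec.cast {p : Prog} {S S' S'' : Mem} {t t' : ℕ} (h : Exec p S S' t) (hS : S' = S'')
    (ht : t ≤ t') : Exec p S S'' t' := hS ▸ h.weaken ht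

theorem Exec.push' {k : Stk} {s : Sym} {S S' : Mem} (h : update S k (s :: S k) = S') :
    Exec (.push k s) S S' 1 := h ▸ .push k s S

theorem Exec.move' {k : Stk} {ks : List Stk} {S S' : Mem} (s : Sym) (r : List Sym)
    (h : S k = s :: r) (h' : Mem.pushAll s ks (update S k r) = S') :
    Exec (.move k ks) S S' 1 := h' ▸ .move k ks S s r h

/-- Move all symbols of a stack to other stacks. -/
def flush (k : Stk) (ks : List Stk) : Prog := .loop k Option.isSome (.move k ks)

/-- The stacks after the word `w` was pushed on each of the stacks `ks`. -/
def Mem.pushWord (ks : List Stk) (w : List Sym) (S : Mem) : Mem :=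
  w.foldl (fun S s => Mem.pushAll s ks S) S

theorem Mem.pushAll_update {k : Stk} {ks : List Stk} (hk : k ∉ ks) (s : Sym) (S : Mem)
    (r : List Sym) : Mem.pushAll s ks (update S k r) = update (Mem.pushAll s ks S) k r := by
  induction ks generalizing S with
  | nil => rfl
  | cons j ks ih =>
    simp only [List.mem_cons, not_or] at hk
    simp only [pushAll]
    rw [update_of_ne (Ne.symm hk.1), update_comm hk.1, ih hk.2]

theorem Mem.pushAll_apply {k : Stk} {ks : List Stk} (hk : k ∉ ks) (s : Sym) (S : Mem) :
    Mem.pushAll s ks S k = S k := by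
  induction ks generalizing S with
  | nil => rfl
  | cons j ks ih =>
    simp only [List.mem_cons, not_or] at hk
    simp only [pushAll]
    rw [ih hk.2, update_of_ne hk.1]

theorem exec_flush {k : Stk} {ks : List Stk} (hk : k ∉ ks) (S : Mem) :
    Exec (flush k ks) S (Mem.pushWord ks (S k) (update S k [])) (2 * (S k).length + 1) := by
  generalize hw : S k = w
  induction w generalizing S with
  | nil =>
    refine (Exec.loop_false (by rw [hw]; rfl)).cast ?_ (by simp)
    rw [← hw]
    simp [Mem.pushWord, hw]
  | cons s w ih =>
    refine (Exec.loop_true (by rw [hw]; rfl) (.move k ks S s w hw) (ih _ ?_)).cast ?_ ?_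
    · rw [Mem.pushAll_apply hk, update_self]
    · simp [Mem.pushWord, Mem.pushAll_update hk]
    · simp; omega

/-- Move the tree on top of the main stack to the stack `k`, where its word arrives reversed. The
counter holds one symbol for each tree that is still to be moved. -/
def takeTree (k : Stk) : Prog :=
  .seq (.push .cnt .close) (.loop .cnt Option.isSome
    (.ite .main (fun s => s = some .item)
      (.seq (.push .cnt .close) (.move .main [k]))
      (.seq (.move .main [k]) (.move .cnt []))))

/-- The loop of `takeTree` processes a tree and then goes on with one tree less to be moved. -/
theorem exec_takeTree_loop {k : Stk} (hk : k ≠ .main) (hk' : k ≠ .cnt) {L body : Prog}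
    (hbody : body = .ite .main (fun s => s = some .item)
      (.seq (.push .cnt .close) (.move .main [k])) (.seq (.move .main [k]) (.move .cnt [])))
    (hL : L = .loop .cnt Option.isSome body) (t : BinTree) (S S' : Mem) (n rest : List Sym)
    (s : Sym) (T : ℕ) (hm : S .main = t.word ++ rest) (hc : S .cnt = s :: n)
    (h : Exec L (update (update (update S .main rest) .cnt n) k (t.word.reverse ++ S k)) S' T) :
    Exec L S S' (4 * t.size + T) := by
  induction t generalizing S n rest s T with
  | leaf =>
    rw [hL] at h ⊢
    refine (Exec.loop_true (t := 3) (by rw [hc]; rfl) ?_ h).weaken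
      (by rw [BinTree.size_leaf]; omega)
    rw [hbody]
    refine .ite_false (by rw [hm]; rfl) (.seq (.move' .close rest (by rw [hm]; rfl) rfl)
      (.move' s n ?_ ?_))
    · simp [Mem.pushAll, hk'.symm, hc]
    · funext j
      simp only [Mem.pushAll, BinTree.word, update_apply]
      split_ifs <;> simp_all
  | node l r ihl ihr =>
    have key : Exec body S (update (update (update S .main (l.word ++ (r.word ++ rest))) .cnt
        (.close :: S .cnt)) k (.item :: S k)) 3 := by
      rw [hbody]
      refine .ite_true (by rw [hm]; rfl) (.seq (.push _ _ _)
        (.move' .item (l.word ++ (r.word ++ rest)) (by simp [hm, BinTree.word]) ?_))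
      funext j
      simp only [Mem.pushAll, update_apply]
      split_ifs <;> simp_all
    have rec1 := ihr (update (update (update S .main (r.word ++ rest)) .cnt (s :: n)) k
      (l.word.reverse ++ (.item :: S k))) n rest s T (by simp [hk.symm]) (by simp [hk'.symm])
      (by
        convert h using 1
        funext j
        simp only [BinTree.word, update_apply]
        split_ifs <;> simp_all)
    have rec2 := ihl (update (update (update S .main (l.word ++ (r.word ++ rest))) .cnt
        (.close :: S .cnt)) k (.item :: S k)) (S .cnt) (r.word ++ rest) .close _
      (by simp [hk.symm]) (by simp [hk'.symm]) (by
        convert rec1 using 1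
        funext j
        simp only [update_apply]
        split_ifs <;> simp_all)
    rw [hL] at rec2 ⊢
    refine (Exec.loop_true (by rw [hc]; rfl) key rec2).weaken ?_
    simp; omega

theorem exec_takeTree {k : Stk} (hk : k ≠ .main) (hk' : k ≠ .cnt) (t : BinTree) (S : Mem)
    (rest : List Sym) (hm : S .main = t.word ++ rest) (hc : S .cnt = []) :
    Exec (takeTree k) S (update (update S .main rest) k (t.word.reverse ++ S k))
      (4 * t.size + 2) := by
  refine (Exec.seq (.push _ _ _) (exec_takeTree_loop hk hk' rfl rfl t _ _ [] rest .close 1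
    (by simp [hm]) (by simp [hc]) ((Exec.loop_false (by simp [hk'.symm])).cast ?_ le_rfl))).cast
    rfl (by omega)
  funext j
  simp only [update_apply]
  split_ifs <;> simp_all

/-- The stacks when only the main stack is in use. -/
def mem (m : List Sym) : Mem := Mem.mk m [] [] [] []

/-- Remove the tree on top of the main stack. -/
def dropTree : Prog := .seq (takeTree .a) (flush .a [])

/-- Duplicate the tree on top of the main stack. -/
def dupTree : Prog :=
  .seq (takeTree .a) (.seq (flush .a [.main, .b]) (.seq (flush .b [.c]) (flush .c [.main])))

/-- Exchange the two trees on top of the main stack. -/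
def swapTree : Prog :=
  .seq (takeTree .a) (.seq (takeTree .b) (.seq (flush .a [.main]) (flush .b [.main])))

/-- Exchange the second and the third tree on the main stack. -/
def swapUnder : Prog :=
  .seq (takeTree .a) (.seq (takeTree .b) (.seq (takeTree .c)
    (.seq (flush .b [.main]) (.seq (flush .c [.main]) (flush .a [.main])))))

section PushWord

variable (m n x y z w : List Sym)

theorem Mem.pushWord_cons (ks : List Stk) (s : Sym) (S : Mem) :
    Mem.pushWord ks (s :: w) S = Mem.pushWord ks w (Mem.pushAll s ks S) := rfl

theorem Mem.pushWord_nil (S : Mem) : Mem.pushWord [] w S = S := by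
  induction w generalizing S with
  | nil => rfl
  | cons s w ih => exact ih _

@[simp] theorem Mem.pushWord_main :
    Mem.pushWord [.main] w (Mem.mk m n x y z) = Mem.mk (w.reverse ++ m) n x y z := by
  induction w generalizing m with
  | nil => rfl
  | cons s w ih =>
    rw [pushWord_cons]
    simp [pushAll, ih]

@[simp] theorem Mem.pushWord_c :
    Mem.pushWord [.c] w (Mem.mk m n x y z) = Mem.mk m n x y (w.reverse ++ z) := by
  induction w generalizing z with
  | nil => rfl
  | cons s w ih =>
    rw [pushWord_cons]
    simp [pushAll, ih]

@[simp] theorem Mem.pushWord_a :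
    Mem.pushWord [.a] w (Mem.mk m n x y z) = Mem.mk m n (w.reverse ++ x) y z := by
  induction w generalizing x with
  | nil => rfl
  | cons s w ih =>
    rw [pushWord_cons]
    simp [pushAll, ih]

@[simp] theorem Mem.pushWord_b :
    Mem.pushWord [.b] w (Mem.mk m n x y z) = Mem.mk m n x (w.reverse ++ y) z := by
  induction w generalizing y with
  | nil => rfl
  | cons s w ih =>
    rw [pushWord_cons]
    simp [pushAll, ih]

@[simp] theorem Mem.pushWord_main_b :
    Mem.pushWord [.main, .b] w (Mem.mk m n x y z) =
      Mem.mk (w.reverse ++ m) n x (w.reverse ++ y) z := by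
  induction w generalizing m y with
  | nil => rfl
  | cons s w ih =>
    rw [pushWord_cons]
    simp [pushAll, ih]

end PushWord

theorem exec_dropTree (t : BinTree) (rest : List Sym) :
    Exec dropTree (mem (t.word ++ rest)) (mem rest) (6 * t.size + 3) := by
  refine (Exec.seq (exec_takeTree (by decide) (by decide) t _ rest rfl rfl)
    (exec_flush (by decide) _)).cast ?_ ?_
  · simp [mem, Mem.pushWord_nil]
  · simp [mem, BinTree.length_word]; omega

theorem exec_dupTree (t : BinTree) (rest : List Sym) :
    Exec dupTree (mem (t.word ++ rest)) (mem (t.word ++ (t.word ++ rest))) (10 * t.size + 5) := by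
  refine (Exec.seq (exec_takeTree (by decide) (by decide) t _ rest rfl rfl)
    (.seq (exec_flush (by decide) _) (.seq (exec_flush (by decide) _)
      (exec_flush (by decide) _)))).cast ?_ ?_
  · simp [mem]
  · simp [mem, BinTree.length_word]; omega

theorem exec_swapTree (t u : BinTree) (rest : List Sym) :
    Exec swapTree (mem (t.word ++ (u.word ++ rest))) (mem (u.word ++ (t.word ++ rest)))
      (6 * (t.size + u.size) + 6) := by
  refine (Exec.seq (exec_takeTree (by decide) (by decide) t _ _ rfl rfl)
    (.seq (exec_takeTree (by decide) (by decide) u _ rest (by simp [mem]) (by simp [mem]))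
    (.seq (exec_flush (by decide) _) (exec_flush (by decide) _)))).cast ?_ ?_
  · simp [mem]
  · simp [mem, BinTree.length_word]; omega

theorem exec_swapUnder (t u v : BinTree) (rest : List Sym) :
    Exec swapUnder (mem (t.word ++ (u.word ++ (v.word ++ rest))))
      (mem (t.word ++ (v.word ++ (u.word ++ rest)))) (6 * (t.size + u.size + v.size) + 9) := by
  refine (Exec.seq (exec_takeTree (by decide) (by decide) t _ _ rfl rfl)
    (.seq (exec_takeTree (by decide) (by decide) u _ _ (by simp [mem]; rfl) (by simp [mem]))
    (.seq (exec_takeTree (by decide) (by decide) v _ rest (by simp [mem]) (by simp [mem]))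
    (.seq (exec_flush (by decide) _) (.seq (exec_flush (by decide) _)
      (exec_flush (by decide) _)))))).cast ?_ ?_
  · simp [mem]
  · simp [mem, BinTree.length_word]; omega

/-! ### Functions computable in polynomial time on tree encodings -/

/-- Types whose elements are represented by binary trees. -/
class Enc (α : Type) where
  enc : α → BinTree

open Enc (enc)

/-- The size of the representation of `a`. -/
def sz {α : Type} [Enc α] (a : α) : ℕ := (enc a).size

/-- The word that represents `a` on a stack. -/
def wd {α : Type} [Enc α] (a : α) : List Sym := (enc a).word

instance : Enc Unit := ⟨fun _ => .leaf⟩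

instance : Enc Bool := ⟨fun b => if b then .node .leaf .leaf else .leaf⟩

instance {α β : Type} [Enc α] [Enc β] : Enc (α × β) := ⟨fun p => .node (enc p.1) (enc p.2)⟩

/-- A list is represented by a right comb. -/
def encComb {α : Type} [Enc α] : List α → BinTree
  | [] => .leaf
  | a :: l => .node (enc a) (encComb l)

instance {α : Type} [Enc α] : Enc (List α) := ⟨encComb⟩

instance {α : Type} [Enc α] : Enc (Option α) :=
  ⟨fun o => o.elim .leaf fun a => .node .leaf (enc a)⟩

/-- A natural number is represented by the list of its binary digits. -/
instance : Enc ℕ := ⟨fun n => enc n.bits⟩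

section Sizes

variable {α β : Type} [Enc α] [Enc β]

@[simp] theorem sz_unit (u : Unit) : sz u = 1 := rfl
@[simp] theorem sz_pair (a : α) (b : β) : sz (a, b) = sz a + sz b + 1 := BinTree.size_node _ _
@[simp] theorem sz_nil : sz ([] : List α) = 1 := rfl
@[simp] theorem sz_cons (a : α) (l : List α) : sz (a :: l) = sz a + sz l + 1 :=
  BinTree.size_node _ _
@[simp] theorem sz_none : sz (none : Option α) = 1 := rfl
@[simp] theorem sz_some (a : α) : sz (some a) = sz a + 2 := by
  refine (BinTree.size_node _ _).trans ?_
  rw [BinTree.size_leaf, sz]; omega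
theorem sz_bool_le (b : Bool) : sz b ≤ 3 := by cases b <;> decide
theorem sz_pos (a : α) : 0 < sz a := by unfold sz; cases enc a <;> simp
theorem length_lt_sz (l : List α) : l.length < sz l := by
  induction l with
  | nil => simp
  | cons a l ih => simp only [List.length_cons, sz_cons]; have := sz_pos a; omega

theorem sz_append (l l' : List α) : sz (l ++ l') + 1 = sz l + sz l' := by
  induction l with
  | nil => simp; omega
  | cons a l ih => simp only [List.cons_append, sz_cons]; omega

theorem exec_drop (a : α) (rest : List Sym) :
    Exec dropTree (mem (wd a ++ rest)) (mem rest) (6 * sz a + 3) := exec_dropTree _ _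

theorem exec_dup (a : α) (rest : List Sym) :
    Exec dupTree (mem (wd a ++ rest)) (mem (wd a ++ (wd a ++ rest))) (10 * sz a + 5) :=
  exec_dupTree _ _

theorem exec_swap (a : α) (b : β) (rest : List Sym) :
    Exec swapTree (mem (wd a ++ (wd b ++ rest))) (mem (wd b ++ (wd a ++ rest)))
      (6 * (sz a + sz b) + 6) := exec_swapTree _ _ _

theorem wd_pair (a : α) (b : β) : wd (a, b) = .item :: (wd a ++ wd b) := rfl

end Sizes

/-- `T` is bounded by a polynomial in the size of the argument. -/
def PolyBd {γ : Type} [Enc γ] (T : γ → ℕ) : Prop := ∃ k, ∀ c, T c ≤ (sz c + 2) ^ k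

section PolyBd

variable {γ δ : Type} [Enc γ] [Enc δ] {T U : γ → ℕ}

theorem PolyBd.mono (h : PolyBd U) (hT : ∀ c, T c ≤ U c) : PolyBd T :=
  let ⟨k, hk⟩ := h
  ⟨k, fun c => (hT c).trans (hk c)⟩

theorem PolyBd.sz : PolyBd (fun c : γ => sz c) := ⟨1, fun c => by simp⟩

theorem PolyBd.const (n : ℕ) : PolyBd (fun _ : γ => n) :=
  ⟨n, fun c => (Nat.lt_pow_self (by omega)).le⟩

theorem PolyBd.mul (h : PolyBd T) (h' : PolyBd U) : PolyBd (fun c => T c * U c) := by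
  obtain ⟨k, hk⟩ := h
  obtain ⟨l, hl⟩ := h'
  exact ⟨k + l, fun c => by rw [pow_add]; exact Nat.mul_le_mul (hk c) (hl c)⟩

theorem PolyBd.add (h : PolyBd T) (h' : PolyBd U) : PolyBd (fun c => T c + U c) := by
  obtain ⟨k, hk⟩ := h
  obtain ⟨l, hl⟩ := h'
  refine ⟨k + l + 1, fun c => ?_⟩
  have h1 : (CakeCutting.sz c + 2) ^ k ≤ (CakeCutting.sz c + 2) ^ (k + l) :=
    Nat.pow_le_pow_right (by omega) (by omega)
  have h2 : (CakeCutting.sz c + 2) ^ l ≤ (CakeCutting.sz c + 2) ^ (k + l) :=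
    Nat.pow_le_pow_right (by omega) (by omega)
  calc T c + U c ≤ (CakeCutting.sz c + 2) ^ (k + l) * 2 := by have := hk c; have := hl c; omega
    _ ≤ _ := by rw [pow_succ]; exact Nat.mul_le_mul le_rfl (by omega)

theorem PolyBd.pow (h : PolyBd T) (n : ℕ) : PolyBd (fun c => T c ^ n) := by
  induction n with
  | zero => exact .const 1
  | succ n ih => exact ih.mul h

theorem PolyBd.comp {V : δ → ℕ} (h : PolyBd V) {f : γ → δ}
    (hf : PolyBd (fun c => CakeCutting.sz (f c))) : PolyBd (fun c => V (f c)) := by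
  obtain ⟨k, hk⟩ := h
  exact ((hf.add (.const 2)).pow k).mono fun c => hk _

end PolyBd

/-- `FP f`: some stack program replaces the representation of an argument `c` on top of the main
stack by that of `f c`, in polynomial time; the rest of the stack is not touched. -/
def FP {γ β : Type} [Enc γ] [Enc β] (f : γ → β) : Prop :=
  ∃ p k, ∀ c, sz (f c) ≤ (sz c + 2) ^ k ∧
    ∀ rest, Exec p (mem (wd c ++ rest)) (mem (wd (f c) ++ rest)) ((sz c + 2) ^ k)

section FP

variable {γ δ β τ α σ : Type} [Enc γ] [Enc δ] [Enc β] [Enc τ] [Enc α] [Enc σ]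

theorem FP.of_exec {f : γ → β} (p : Prog) (T : γ → ℕ) (hT : PolyBd T)
    (hf : PolyBd fun c => sz (f c))
    (h : ∀ c rest, Exec p (mem (wd c ++ rest)) (mem (wd (f c) ++ rest)) (T c)) : FP f := by
  obtain ⟨k, hk⟩ := hT.add hf
  exact ⟨p, k, fun c => ⟨(Nat.le_add_left _ _).trans (hk c), fun rest =>
    (h c rest).weaken ((Nat.le_add_right _ _).trans (hk c))⟩⟩

theorem FP.sz_bd {f : γ → β} (h : FP f) : PolyBd fun c => sz (f c) :=
  let ⟨_, k, h⟩ := h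
  ⟨k, fun c => (h c).1⟩

theorem FP.exists_exec {f : γ → β} (h : FP f) : ∃ (p : Prog) (T : γ → ℕ), PolyBd T ∧
    ∀ c rest, Exec p (mem (wd c ++ rest)) (mem (wd (f c) ++ rest)) (T c) :=
  let ⟨p, k, h⟩ := h
  ⟨p, _, ⟨k, fun _ => le_rfl⟩, fun c => (h c).2⟩

theorem FP.id : FP (fun c : γ => c) :=
  .of_exec .skip (fun _ => 1) (.const 1) .sz fun _ _ => .skip _

theorem FP.comp {g : δ → β} (hg : FP g) {f : γ → δ} (hf : FP f) : FP (fun c => g (f c)) := by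
  obtain ⟨p, T, hT, h⟩ := hf.exists_exec
  obtain ⟨q, U, hU, h'⟩ := hg.exists_exec
  exact .of_exec (.seq p q) _ (hT.add (hU.comp hf.sz_bd)) (hg.sz_bd.comp hf.sz_bd)
    fun c rest => .seq (h c rest) (h' (f c) rest)

/-- A function that only changes how a tree is read. -/
theorem FP.retype {f : γ → β} (h : ∀ c, enc (f c) = enc c) : FP f :=
  .of_exec .skip (fun _ => 1) (.const 1) (PolyBd.sz.mono fun c => by rw [sz, h, sz])
    fun c rest => by rw [wd, wd, h]; exact .skip _

theorem FP.congr {f g : γ → β} (hf : FP f) (h : ∀ c, f c = g c) : FP g := funext h ▸ hf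

theorem FP.pair {f : γ → β} {g : γ → δ} (hf : FP f) (hg : FP g) : FP (fun c => (f c, g c)) := by
  obtain ⟨p, T, hT, h⟩ := hf.exists_exec
  obtain ⟨q, U, hU, h'⟩ := hg.exists_exec
  refine .of_exec (.seq dupTree (.seq q (.seq swapTree (.seq p (.push .main .item)))))
    (fun c => (10 * sz c + 5) + (U c + ((6 * (sz (g c) + sz c) + 6) + (T c + 1))))
    (((PolyBd.const 10).mul .sz).add (.const 5) |>.add (hU.add
      ((((PolyBd.const 6).mul (hg.sz_bd.add .sz)).add (.const 6)).add (hT.add (.const 1)))))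
    (((hf.sz_bd.add hg.sz_bd).add (.const 1)).mono fun c => by simp) fun c rest => ?_
  exact .seq (exec_dup _ _) (.seq (h' c _) (.seq (exec_swap _ _ _) (.seq (h c _)
    (.push' (by simp [mem, wd_pair])))))

theorem FP.fst : FP (fun p : γ × δ => p.1) := by
  refine .of_exec (.seq (.move .main []) (.seq swapTree dropTree))
    (fun p => 1 + (6 * (sz p.1 + sz p.2) + 6 + (6 * sz p.2 + 3))) ?_
    (PolyBd.sz.mono fun p => ?_) fun p rest => ?_
  · exact ((PolyBd.const 18).mul (PolyBd.sz (γ := γ × δ))).mono fun p => by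
      rcases p with ⟨a, b⟩; simp only [sz_pair]; have := sz_pos a; omega
  · rcases p with ⟨a, b⟩; simp only [sz_pair]; omega
  · exact .seq (.move' .item (wd p.1 ++ (wd p.2 ++ rest)) (by rcases p; simp [wd_pair, mem])
      (by simp [Mem.pushAll, mem])) (.seq (exec_swap _ _ _) (exec_drop _ _))

theorem FP.snd : FP (fun p : γ × δ => p.2) := by
  refine .of_exec (.seq (.move .main []) dropTree)
    (fun p => 1 + (6 * sz p.1 + 3)) ?_ (PolyBd.sz.mono fun p => ?_) fun p rest => ?_
  · exact ((PolyBd.const 6).mul (PolyBd.sz (γ := γ × δ))).mono fun p => by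
      rcases p with ⟨a, b⟩; simp only [sz_pair]; have := sz_pos a; omega
  · rcases p with ⟨a, b⟩; simp only [sz_pair]; omega
  · exact .seq (.move' .item (wd p.1 ++ (wd p.2 ++ rest)) (by rcases p; simp [wd_pair, mem])
      (by simp [Mem.pushAll, mem])) (exec_drop _ _)

/-- Push the word `w` on the main stack, its last symbol first. -/
def pushWordProg (w : List Sym) : Prog := w.foldl (fun p s => .seq (.push .main s) p) .skip

theorem exec_pushWordProg (w m n x y z : List Sym) (p : Prog) (S : Mem) (T : ℕ)
    (h : Exec p (Mem.mk (w ++ m) n x y z) S T) :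
    Exec (w.foldl (fun p s => .seq (.push .main s) p) p) (Mem.mk m n x y z) S (w.length + T) := by
  induction w generalizing p T with
  | nil => simpa using h
  | cons s w ih =>
    refine (ih (.seq (.push .main s) p) _ (.seq
      (.push' (S' := Mem.mk (s :: w ++ m) n x y z) ?_) h)).weaken ?_
    · simp
    · simp; omega

theorem FP.const (b : β) : FP (fun _ : γ => b) := by
  refine .of_exec (.seq dropTree (pushWordProg (wd b))) (fun c => 6 * sz c + 3 + (sz b + 1))
    ((((PolyBd.const 6).mul .sz).add (.const 3)).add (.const _)) (.const _) fun c rest => ?_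
  exact .seq (exec_drop _ _) (exec_pushWordProg _ _ _ _ _ _ _ _ _ (.skip _))

/-- Case distinction on the value of `t`: whether its representation is a leaf or not. -/
theorem FP.branch {t : γ → τ} (ht : FP t) {f : γ → β} (hf : FP f) {g : γ × δ → β} (hg : FP g)
    (h : γ → β) (H : ∀ c, (enc (t c) = .leaf ∧ h c = f c) ∨
      ∃ d : δ, enc (t c) = enc d ∧ enc d ≠ .leaf ∧ h c = g (c, d)) : FP h := by
  obtain ⟨p, T, hT, ep⟩ := hf.exists_exec
  obtain ⟨q, U, hU, eq⟩ := hg.exists_exec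
  obtain ⟨r, V, hV, er⟩ := ht.exists_exec
  obtain ⟨k, hk⟩ := hU
  obtain ⟨l, hl⟩ := hg.sz_bd
  have sb : PolyBd fun c => sz c + sz (t c) + 1 := (PolyBd.sz.add ht.sz_bd).add (.const 1)
  refine .of_exec (.seq dupTree (.seq r (.ite .main (fun s => s = some .item)
      (.seq swapTree (.seq (.push .main .item) q)) (.seq (.move .main []) p))))
    (fun c => (10 * sz c + 5) + (V c + ((6 * (sz (t c) + sz c) + 6) +
      (1 + (sz c + sz (t c) + 1 + 2) ^ k) + (1 + T c) + 1)))
    (((PolyBd.const 10).mul .sz).add (.const 5) |>.add (hV.add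
      (((((PolyBd.const 6).mul (ht.sz_bd.add .sz)).add (.const 6)).add
        ((PolyBd.const 1).add ((sb.add (.const 2)).pow k))).add ((PolyBd.const 1).add hT) |>.add
          (.const 1))))
    ((hf.sz_bd.add ((sb.add (.const 2)).pow l)).mono fun c => ?_) fun c rest => ?_
  · rcases H c with ⟨-, e⟩ | ⟨d, hd, -, e⟩
    · rw [e]; exact Nat.le_add_right _ _
    · rw [e]
      refine ((hl (c, d)).trans ?_).trans (Nat.le_add_left _ _)
      rw [sz_pair, show sz (t c) = sz d by rw [sz, hd, sz]]
  · refine .seq (exec_dup _ _) (.seq (er c _) ?_)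
    rcases H c with ⟨hd, e⟩ | ⟨d, hd, hn, e⟩
    · rw [e, wd, hd]
      exact (Exec.ite_false rfl (.seq (.move' .close (wd c ++ rest) rfl
        (by simp [Mem.pushAll, mem])) (ep c rest))).weaken (by omega)
    · rw [e, show wd (t c) = wd d by rw [wd, hd, wd]]
      refine (Exec.ite_true (t := (6 * (sz d + sz c) + 6) + (1 + (sz c + sz (t c) + 1 + 2) ^ k)) ?_
        (.seq (exec_swap d c rest) (.seq (.push' (S' := mem (wd (c, d) ++ rest)) ?_)
          ((eq (c, d) rest).weaken ?_)))).weaken ?_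
      · rw [wd]
        cases hh : enc d with
        | leaf => exact absurd hh hn
        | node l r => rfl
      · simp [mem, wd_pair]
      · refine (hk _).trans (le_of_eq ?_)
        rw [sz_pair, show sz (t c) = sz d by rw [sz, hd, sz]]
      · have : sz (t c) = sz d := by rw [sz, sz, hd]
        rw [this]; omega

theorem FP.ite {t : γ → Bool} (ht : FP t) {f g : γ → β} (hf : FP f) (hg : FP g) :
    FP (fun c => if t c then f c else g c) := by
  refine .branch ht hg (δ := Bool) (g := fun p => f p.1) (hf.comp .fst) _ fun c => ?_
  cases h : t c
  · exact .inl ⟨rfl, by simp⟩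
  · exact .inr ⟨true, rfl, by simp [enc], by simp⟩

theorem FP.list_cases {l : γ → List α} (hl : FP l) {f : γ → β} (hf : FP f)
    {g : γ → α → List α → β} (hg : FP (fun p : γ × α × List α => g p.1 p.2.1 p.2.2)) :
    FP (fun c => match l c with
      | [] => f c
      | a :: t => g c a t) := by
  refine .branch hl hf hg _ fun c => ?_
  rcases l c with _ | ⟨a, t⟩
  · exact .inl ⟨rfl, rfl⟩
  · exact .inr ⟨(a, t), rfl, by simp [enc], rfl⟩

theorem FP.option_cases {l : γ → Option α} (hl : FP l) {f : γ → β} (hf : FP f)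
    {g : γ → α → β} (hg : FP (fun p : γ × α => g p.1 p.2)) :
    FP (fun c => match l c with
      | none => f c
      | some a => g c a) := by
  refine .branch hl hf (δ := Unit × α) (g := fun p => g p.1 p.2.2)
    (hg.comp (FP.fst.pair (FP.snd.comp .snd))) _ fun c => ?_
  rcases l c with _ | a
  · exact .inl ⟨rfl, rfl⟩
  · exact .inr ⟨((), a), rfl, by simp [enc], rfl⟩

theorem FP.cons {f : γ → α} {g : γ → List α} (hf : FP f) (hg : FP g) :
    FP (fun c => f c :: g c) :=
  (FP.retype (f := fun p : α × List α => p.1 :: p.2) fun _ => rfl).comp (hf.pair hg)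

theorem FP.optionSome {f : γ → α} (hf : FP f) : FP (fun c => some (f c)) :=
  (FP.retype (f := fun p : Unit × α => some p.2) fun _ => rfl).comp ((FP.const ()).pair hf)

end FP

section Fold

variable {γ α σ : Type} [Enc γ] [Enc α] [Enc σ]

/-- The body of the loop of a fold: the main stack holds the list and, below it, the accumulator. -/
def foldBody (p : Prog) : Prog :=
  .seq (.move .main []) (.seq swapUnder (.seq (.push .main .item) (.seq p swapTree)))

theorem exec_foldLoop (p : Prog) (f : σ → α → σ) (B U : ℕ)
    (hp : ∀ a s rest, sz a ≤ B → sz s ≤ B →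
      Exec p (mem (wd (a, s) ++ rest)) (mem (wd (f s a) ++ rest)) U)
    (l : List α) (hl : sz l ≤ B) (s : σ)
    (hs : ∀ l₁ l₂, l = l₁ ++ l₂ → sz (l₁.foldl f s) ≤ B) (rest : List Sym) :
    Exec (.loop .main (fun s => s = some .item) (foldBody p)) (mem (wd l ++ (wd s ++ rest)))
      (mem (wd ([] : List α) ++ (wd (l.foldl f s) ++ rest)))
      (l.length * (30 * B + U + 18) + 1) := by
  induction l generalizing s with
  | nil => exact (Exec.loop_false rfl).weaken (by simp)
  | cons a l ih =>
    rw [sz_cons] at hl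
    have hs0 := hs [] _ rfl
    have hs1 := hs [a] _ rfl
    simp only [List.foldl_nil, List.foldl_cons] at hs0 hs1
    refine (Exec.loop_true rfl (.seq (.move' .item (wd a ++ (wd l ++ (wd s ++ rest))) ?_ ?_)
      (.seq (exec_swapUnder (enc a) (enc l) (enc s) rest)
        (.seq (.push' (S' := mem (wd (a, s) ++ (wd l ++ rest))) ?_)
        (.seq (hp a s (wd l ++ rest) (by omega) hs0) (exec_swap _ _ _)))))
      (ih (by omega) (f s a) fun l₁ l₂ h => hs (a :: l₁) l₂ (by rw [h]; rfl))).weaken ?_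
    · simp [mem, wd, enc, encComb, BinTree.word]
    · simp [mem, Mem.pushAll, wd]
    · simp [mem, wd_pair]; rfl
    · change 1 + (6 * (sz a + sz l + sz s) + 9 + (1 + (U + (6 * (sz (f s a) + sz l) + 6)))) +
        (l.length * (30 * B + U + 18) + 1) + 1 ≤ (l.length + 1) * (30 * B + U + 18) + 1
      rw [add_mul]
      omega

/-- A fold is feasible if each step is and all intermediate results are of polynomial size. -/
theorem FP.foldl_of_bound {L : γ → List α} (hL : FP L) {i : γ → σ} (hi : FP i) {f : σ → α → σ}
    (hf : FP (fun p : α × σ => f p.2 p.1)) {B : γ → ℕ} (hB : PolyBd B)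
    (h : ∀ c l₁ l₂, L c = l₁ ++ l₂ → sz (l₁.foldl f (i c)) ≤ B c) :
    FP (fun c => (L c).foldl f (i c)) := by
  obtain ⟨p, T, hT, ep⟩ := (hL.pair hi).exists_exec
  obtain ⟨q, k, eq⟩ := hf
  have hLl : PolyBd fun c => (L c).length := hL.sz_bd.mono fun c => (length_lt_sz _).le
  have hU : PolyBd fun c => (2 * (B c + sz (L c)) + 3) ^ k :=
    ((((PolyBd.const 2).mul (hB.add hL.sz_bd))).add (.const 3)).pow k
  refine .of_exec (.seq p (.seq (.move .main [])
      (.seq (.loop .main (fun s => s = Option.some Sym.item) (foldBody q)) (.move .main []))))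
    (fun c => T c + (1 + ((L c).length *
      (30 * (B c + sz (L c)) + (2 * (B c + sz (L c)) + 3) ^ k + 18) + 1 + 1)))
    (hT.add ((PolyBd.const 1).add (((hLl.mul (((PolyBd.const 30).mul (hB.add hL.sz_bd)).add hU
      |>.add (.const 18))).add (.const 1)).add (.const 1))))
    (hB.mono fun c => h c _ [] (by simp)) fun c rest => ?_
  refine .seq (ep c rest) (.seq (.move' .item (wd (L c) ++ (wd (i c) ++ rest)) ?_ ?_)
    (.seq (exec_foldLoop q f (B c + sz (L c)) _ ?_ (L c) (by omega) _ ?_ rest)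
      (.move' (S := mem (wd ([] : List α) ++ (wd ((L c).foldl f (i c)) ++ rest))) .close
        (wd ((L c).foldl f (i c)) ++ rest) rfl ?_)))
  · simp [mem, wd_pair]
  · simp [mem, Mem.pushAll]
  · intro a s rest ha hs
    refine ((eq (a, s)).2 rest).weaken (Nat.pow_le_pow_left ?_ k)
    rw [sz_pair]; omega
  · intro l₁ l₂ e
    have := h c l₁ l₂ e
    omega
  · simp [mem, Mem.pushAll]

/-- A fold is feasible if each step is, and adds to the size of the accumulator at most a quantity
that is polynomial in the sizes of the parameters and of the current list element. -/
theorem FP.foldl {L : γ → List α} (hL : FP L) {i : γ → σ} (hi : FP i) {f : γ → σ → α → σ}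
    (hf : FP (fun p : γ × α × σ => f p.1 p.2.2 p.2.1)) {B : γ × α → ℕ} (hB : PolyBd B)
    (h : ∀ c s a, sz (f c s a) ≤ sz s + B (c, a)) :
    FP (fun c => (L c).foldl (f c) (i c)) := by
  obtain ⟨k, hk⟩ := hB
  have key : ∀ c (l : List α) (s : σ), l.foldl (fun q a => (q.1, f q.1 q.2 a)) (c, s) =
      (c, l.foldl (f c) s) := fun c l => by
    induction l with
    | nil => exact fun _ => rfl
    | cons a l ih => exact fun s => ih _
  have step : FP (fun p : α × (γ × σ) => (p.2.1, f p.2.1 p.2.2 p.1)) :=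
    (FP.fst.comp .snd).pair (hf.comp ((FP.fst.comp .snd).pair
      (FP.fst.pair (FP.snd.comp .snd))))
  have bound : ∀ c (l : List α) (N : ℕ), sz l ≤ N → ∀ s,
      sz (l.foldl (f c) s) ≤ sz s + l.length * (sz c + N + 1 + 2) ^ k := fun c l N => by
    induction l with
    | nil => simp
    | cons a l ih =>
      intro hN s
      rw [sz_cons] at hN
      have h1 := ih (by omega) (f c s a)
      have h2 := (h c s a).trans (Nat.add_le_add_left (hk (c, a)) _)
      have h3 : (sz (c, a) + 2) ^ k ≤ (sz c + N + 1 + 2) ^ k :=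
        Nat.pow_le_pow_left (by rw [sz_pair]; omega) k
      rw [List.foldl_cons, List.length_cons, add_mul, one_mul]
      omega
  have hLl : PolyBd fun c => (L c).length := hL.sz_bd.mono fun c => (length_lt_sz _).le
  have := FP.foldl_of_bound hL (FP.id.pair hi) (f := fun q a => (q.1, f q.1 q.2 a)) step
    (B := fun c => sz c + (sz (i c) + (L c).length * (sz c + sz (L c) + 1 + 2) ^ k) + 1)
    ((PolyBd.sz.add (hi.sz_bd.add (hLl.mul ((((PolyBd.sz.add hL.sz_bd).add (.const 1)).add
      (.const 2)).pow k)))).add (.const 1)) fun c l₁ l₂ e => by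
        have h1 := sz_append l₁ l₂
        have h2 := sz_pos l₂
        have h3 := bound c l₁ (sz (L c)) (by rw [e]; omega) (i c)
        have h4 : l₁.length * (sz c + sz (L c) + 1 + 2) ^ k ≤
            (L c).length * (sz c + sz (L c) + 1 + 2) ^ k :=
          Nat.mul_le_mul_right _ (by rw [e]; simp)
        rw [key, sz_pair]
        omega
  exact (FP.snd.comp this).congr fun c => by rw [key]

end Fold

/-! ### Feasible functions on lists -/

section Lists

variable {γ δ β τ α σ : Type} [Enc γ] [Enc δ] [Enc β] [Enc τ] [Enc α] [Enc σ]

theorem FP.of_enc_eq {f : γ → β} (hf : FP f) {g : γ → δ} (h : ∀ c, enc (g c) = enc (f c)) :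
    FP g := by
  obtain ⟨p, k, hp⟩ := hf
  refine ⟨p, k, fun c => ?_⟩
  have hs : sz (g c) = sz (f c) := congrArg BinTree.size (h c)
  have hw : wd (g c) = wd (f c) := congrArg BinTree.word (h c)
  rw [hs, hw]
  exact hp c

theorem FP.reverse {L : γ → List α} (hL : FP L) : FP fun c => (L c).reverse := by
  refine (FP.foldl hL (FP.const []) (f := fun _ l a => a :: l)
    ((FP.fst.comp .snd).cons (FP.snd.comp .snd)) (B := fun p => sz p) .sz fun c s a => ?_).congr
      fun c => by simp
  simp only [sz_cons, sz_pair]; omega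

theorem FP.map {L : γ → List α} (hL : FP L) {g : γ → α → β}
    (hg : FP fun p : γ × α => g p.1 p.2) : FP fun c => (L c).map (g c) := by
  refine (FP.foldl hL.reverse (FP.const []) (f := fun c l a => g c a :: l)
    ((hg.comp (FP.fst.pair (FP.fst.comp .snd))).cons (FP.snd.comp .snd))
    (B := fun p => sz (g p.1 p.2) + 1) (hg.sz_bd.add (.const 1)) fun c s a => ?_).congr
      fun c => by simp
  simp only [sz_cons]; omega

theorem FP.append {f g : γ → List α} (hf : FP f) (hg : FP g) : FP fun c => f c ++ g c := by
  refine (FP.foldl hf.reverse hg (f := fun _ l a => a :: l)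
    ((FP.fst.comp .snd).cons (FP.snd.comp .snd)) (B := fun p => sz p) .sz fun c s a => ?_).congr
      fun c => by simp
  simp only [sz_cons, sz_pair]; omega

theorem FP.flatMap {L : γ → List α} (hL : FP L) {g : γ → α → List β}
    (hg : FP fun p : γ × α => g p.1 p.2) : FP fun c => (L c).flatMap (g c) := by
  refine (FP.foldl hL.reverse (FP.const []) (f := fun c l a => g c a ++ l)
    ((hg.comp (FP.fst.pair (FP.fst.comp .snd))).append (FP.snd.comp .snd))
    (B := fun p => sz (g p.1 p.2)) hg.sz_bd fun c s a => ?_).congr fun c => ?_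
  · have := sz_append (g c a) s
    change _ ≤ _ + sz (g c a)
    omega
  · rw [List.foldl_reverse]
    induction L c with
    | nil => rfl
    | cons a l ih => rw [List.foldr_cons, ih, List.flatMap_cons]

theorem FP.tail {L : γ → List α} (hL : FP L) : FP fun c => (L c).tail :=
  (hL.list_cases (FP.const []) (g := fun _ _ t => t) (FP.snd.comp .snd)).congr fun c => by
    cases L c <;> rfl

theorem FP.not {f : γ → Bool} (hf : FP f) : FP fun c => !f c :=
  (hf.ite (.const false) (.const true)).congr fun c => by cases f c <;> rfl

theorem FP.and {f g : γ → Bool} (hf : FP f) (hg : FP g) : FP fun c => f c && g c :=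
  (hf.ite hg (.const false)).congr fun c => by cases f c <;> rfl

theorem FP.xor {f g : γ → Bool} (hf : FP f) (hg : FP g) : FP fun c => xor (f c) (g c) :=
  (hf.ite hg.not hg).congr fun c => by cases f c <;> simp

theorem FP.any {L : γ → List α} (hL : FP L) {g : γ → α → Bool}
    (hg : FP fun p : γ × α => g p.1 p.2) : FP fun c => (L c).any (g c) := by
  refine (FP.foldl hL (FP.const false) (f := fun c b a => if g c a then true else b)
    ((hg.comp (FP.fst.pair (FP.fst.comp .snd))).ite (.const true) (FP.snd.comp .snd))
    (B := fun _ => 3) (.const 3) fun c s a => ?_).congr fun c => ?_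
  · exact (sz_bool_le _).trans (Nat.le_add_left _ _)
  · have : ∀ (l : List α) (b : Bool),
        l.foldl (fun b a => if g c a then true else b) b = (b || l.any (g c)) := fun l => by
      induction l with
      | nil => simp
      | cons a l ih => intro b; rw [List.foldl_cons, ih]; cases h : g c a <;> simp [h]
    exact (this _ _).trans (Bool.false_or _)

end Lists

/-! ### Feasible binary arithmetic -/

section Arithmetic

variable {γ : Type} [Enc γ]

theorem enc_nat (n : ℕ) : enc n = enc n.bits := rfl

theorem FP.bits {f : γ → ℕ} (hf : FP f) : FP fun c => (f c).bits :=
  hf.of_enc_eq fun _ => rfl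

/-- The number with the given binary digits, least significant digit first. -/
def ofBits (l : List Bool) : ℕ := l.foldr Nat.bit 0

theorem ofBits_bits (n : ℕ) : ofBits n.bits = n := by
  induction n using Nat.binaryRec' with
  | zero => simp [ofBits]
  | bit b n h ih => rw [Nat.bits_append_bit _ _ h]; exact congrArg _ ih

theorem FP.isZero {f : γ → ℕ} (hf : FP f) : FP fun c => decide (f c = 0) := by
  refine (hf.bits.list_cases (.const true) (g := fun _ _ _ => false) (.const false)).congr
    fun c => ?_
  cases h : (f c).bits with
  | nil =>
    have : f c = 0 := by rw [← ofBits_bits (f c), h]; rfl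
    simp [this]
  | cons b l =>
    have : f c ≠ 0 := fun h0 => by simp [h0] at h
    simp [this]

theorem FP.div2 {f : γ → ℕ} (hf : FP f) : FP fun c => (f c).div2 :=
  hf.bits.tail.of_enc_eq fun c => by rw [enc_nat, Nat.div2_bits_eq_tail]

theorem FP.bodd {f : γ → ℕ} (hf : FP f) : FP fun c => (f c).bodd :=
  (hf.bits.list_cases (.const false) (g := fun _ b _ => b) (FP.fst.comp .snd)).congr fun c => by
    rw [Nat.bodd_eq_bits_head]; cases (f c).bits <;> rfl

theorem bits_bit (b : Bool) (n : ℕ) :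
    (Nat.bit b n).bits = if !b && decide (n = 0) then [] else b :: n.bits := by
  cases b
  · by_cases h : n = 0
    · subst h; rfl
    · rw [Nat.bits_append_bit _ _ fun h' => absurd h' h]; simp [h]
  · rw [Nat.bits_append_bit _ _ fun _ => rfl]; simp

theorem FP.bit {f : γ → Bool} {g : γ → ℕ} (hf : FP f) (hg : FP g) :
    FP fun c => Nat.bit (f c) (g c) :=
  ((hf.not.and hg.isZero).ite (.const []) (hf.cons hg.bits)).of_enc_eq fun c => by
    rw [enc_nat, bits_bit]

theorem sz_nat (n : ℕ) : sz n = sz n.bits := rfl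

theorem sz_bit_le (b : Bool) (n : ℕ) : sz (Nat.bit b n) ≤ sz b + sz n + 1 := by
  rw [sz_nat, sz_nat, bits_bit]
  split_ifs <;> simp

theorem sz_div2_le (n : ℕ) : sz n.div2 ≤ sz n := by
  rw [sz_nat, sz_nat, Nat.div2_bits_eq_tail]
  cases n.bits with
  | nil => exact le_rfl
  | cons b l => simp only [List.tail_cons, sz_cons]; omega

/-- The number with the given binary digits, most significant digit first, which are preceded by
those of `n`. -/
def appendBits (n : ℕ) (l : List Bool) : ℕ := l.foldl (fun n b => Nat.bit b n) n

theorem appendBits_reverse (l : List Bool) : appendBits 0 l.reverse = ofBits l := by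
  rw [appendBits, List.foldl_reverse, ofBits]

theorem FP.appendBits {f : γ → ℕ} {g : γ → List Bool} (hf : FP f) (hg : FP g) :
    FP fun c => appendBits (f c) (g c) := by
  refine FP.foldl hg hf (f := fun _ n b => Nat.bit b n) ((FP.fst.comp .snd).bit (FP.snd.comp .snd))
    (B := fun p => sz p) .sz fun c n b => (sz_bit_le _ _).trans ?_
  rw [sz_pair]; omega

/-- One digit of an addition. The state consists of the remaining digits of the second summand, the
carry, and the digits of the sum found so far. -/
def addStep (s : ℕ × Bool × List Bool) (b : Bool) : ℕ × Bool × List Bool :=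
  (s.1.div2, (if xor b s.1.bodd then s.2.1 else b), xor (xor b s.1.bodd) s.2.1 :: s.2.2)

/-- The identity behind a full adder: the new digit, and the new carry in front of it. -/
theorem bit_add (b c : Bool) (m n : ℕ) : Nat.bit (xor (xor b n.bodd) c)
    (m + n.div2 + (if xor b n.bodd then c else b).toNat) = Nat.bit b m + n + c.toNat := by
  have h := Nat.bodd_add_div2 n
  cases hn : n.bodd <;> cases b <;> cases c <;> simp [Nat.bit, hn] at h ⊢ <;> omega

/-- The invariant of the addition: what is still to be added, followed by the digits found so far,
denotes the sum. -/
theorem foldl_addStep (l : List Bool) (s : ℕ × Bool × List Bool) :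
    appendBits ((l.foldl addStep s).1 + (l.foldl addStep s).2.1.toNat) (l.foldl addStep s).2.2 =
      appendBits (ofBits l + s.1 + s.2.1.toNat) s.2.2 := by
  induction l generalizing s with
  | nil => simp [ofBits]
  | cons b l ih =>
    rw [List.foldl_cons, ih]
    exact congrArg (appendBits · s.2.2) (bit_add b s.2.1 (ofBits l) s.1)

theorem FP.foldl_addStep {L : γ → List Bool} {f : γ → ℕ} {c : γ → Bool} (hL : FP L) (hf : FP f)
    (hc : FP c) : FP fun x => (L x).foldl addStep (f x, c x, []) := by
  have h1 : FP fun p : γ × Bool × (ℕ × Bool × List Bool) =>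
      Bool.xor p.2.1 p.2.2.1.bodd :=
    (FP.fst.comp .snd).xor (FP.fst.comp (FP.snd.comp .snd)).bodd
  have h2 : FP fun p : γ × Bool × (ℕ × Bool × List Bool) => p.2.2.2.1 :=
    FP.fst.comp (FP.snd.comp (FP.snd.comp .snd))
  refine FP.foldl hL (hf.pair (hc.pair (.const []))) (f := fun _ => addStep)
    ((FP.fst.comp (FP.snd.comp .snd)).div2.pair ((h1.ite h2 (FP.fst.comp .snd)).pair
      ((h1.xor h2).cons (FP.snd.comp (FP.snd.comp (FP.snd.comp .snd))))))
    (B := fun _ => 10) (.const 10) fun _ s b => ?_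
  obtain ⟨n, c, l⟩ := s
  simp only [addStep, sz_pair, sz_cons]
  have := sz_div2_le n
  have := sz_bool_le (if Bool.xor b n.bodd then c else b)
  have := sz_bool_le (Bool.xor (Bool.xor b n.bodd) c)
  omega

theorem FP.succ {f : γ → ℕ} (hf : FP f) : FP fun c => f c + 1 := by
  have h := FP.foldl_addStep hf.bits (.const 0) (.const true)
  refine (FP.appendBits ((FP.fst.comp (FP.snd.comp h)).ite (.const 1) (.const 0))
    (FP.snd.comp (FP.snd.comp h))).congr fun c => ?_
  have h1 := CakeCutting.foldl_addStep (f c).bits (0, true, [])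
  have h2 : ∀ (l : List Bool) (s : ℕ × Bool × List Bool), s.1 = 0 → (l.foldl addStep s).1 = 0 :=
    fun l => by
      induction l with
      | nil => exact fun _ h => h
      | cons b l ih => exact fun s h => ih _ (by rw [addStep, h]; rfl)
  rw [h2 _ _ rfl, ofBits_bits, zero_add] at h1
  refine Eq.trans ?_ h1
  congr 1
  cases (List.foldl addStep (0, true, []) (f c).bits).2.1 <;> rfl

theorem FP.add {f g : γ → ℕ} (hf : FP f) (hg : FP g) : FP fun c => f c + g c := by
  have h := FP.foldl_addStep hf.bits hg (.const false)
  refine (FP.appendBits ((FP.fst.comp (FP.snd.comp h)).ite (FP.fst.comp h).succ (FP.fst.comp h))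
    (FP.snd.comp (FP.snd.comp h))).congr fun c => ?_
  have h1 := CakeCutting.foldl_addStep (f c).bits (g c, false, [])
  rw [ofBits_bits] at h1
  refine Eq.trans ?_ h1
  congr 1
  cases (List.foldl addStep (g c, false, []) (f c).bits).2.1 <;> rfl

theorem sz_nat_le {n k : ℕ} (h : n < 2 ^ k) : sz n ≤ 4 * k + 1 := by
  have h1 : n.bits.length ≤ k := by
    rw [Nat.size_eq_bits_len]; exact Nat.size_le.2 h
  have h2 : ∀ l : List Bool, sz l ≤ 4 * l.length + 1 := fun l => by
    induction l with
    | nil => simp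
    | cons b l ih => simp only [sz_cons, List.length_cons]; have := sz_bool_le b; omega
  have := h2 n.bits
  rw [sz_nat]; omega

theorem lt_two_pow_sz (n : ℕ) : n < 2 ^ sz n :=
  Nat.size_le.1 (by rw [← Nat.size_eq_bits_len]; exact (length_lt_sz n.bits).le)

/-- One digit of a multiplication, most significant digit of the first factor first. The state
consists of the second factor and the product found so far. -/
def mulStep (s : ℕ × ℕ) (b : Bool) : ℕ × ℕ :=
  (s.1, if b then Nat.bit false s.2 + s.1 else Nat.bit false s.2)

/-- Horner's scheme: reading a further digit doubles the product and adds the second factor if the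
digit is one. -/
theorem foldl_mulStep (n : ℕ) (l : List Bool) :
    l.foldl mulStep (n, 0) = (n, ofBits l.reverse * n) := by
  induction l using List.reverseRecOn with
  | nil => simp [ofBits]
  | append_singleton l b ih =>
    rw [List.foldl_append, ih, List.reverse_append]
    change (n, _) = (n, Nat.bit b (ofBits l.reverse) * n)
    cases b <;> simp [Nat.bit] <;> ring

theorem ofBits_lt (l : List Bool) : ofBits l < 2 ^ l.length := by
  induction l with
  | nil => simp [ofBits]
  | cons b l ih =>
    change Nat.bit b (ofBits l) < _
    rw [List.length_cons, pow_succ]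
    cases b <;> simp [Nat.bit] <;> omega

theorem sz_mulStep_le (m n : ℕ) (l₁ l₂ : List Bool) (h : m.bits.reverse = l₁ ++ l₂) :
    sz (l₁.foldl mulStep (n, 0)) ≤ sz n + (4 * (m.bits.length + sz n) + 1) + 1 := by
  have h1 : l₁.length ≤ m.bits.length := by
    rw [← List.length_reverse (as := m.bits), h]; simp
  have h2 : ofBits l₁.reverse * n < 2 ^ (m.bits.length + sz n) := by
    rw [pow_add]
    refine Nat.mul_lt_mul_of_le_of_lt ?_ (lt_two_pow_sz n) (Nat.pow_pos (by omega))
    exact (ofBits_lt _).le.trans (Nat.pow_le_pow_right (by omega) (by simpa using h1))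
  have := sz_nat_le h2
  rw [foldl_mulStep, sz_pair]
  omega

theorem FP.mul {f g : γ → ℕ} (hf : FP f) (hg : FP g) : FP fun c => f c * g c := by
  have hb : FP fun p : Bool × ℕ × ℕ => Nat.bit false p.2.2 :=
    FP.bit (.const false) (FP.snd.comp .snd)
  have hs : FP fun p : Bool × ℕ × ℕ => mulStep p.2 p.1 :=
    (FP.fst.comp .snd).pair (FP.fst.ite (hb.add (FP.fst.comp .snd)) hb)
  have hl : PolyBd fun c => (f c).bits.length :=
    hf.bits.sz_bd.mono fun c => (length_lt_sz _).le
  refine (FP.snd.comp (FP.foldl_of_bound hf.bits.reverse (hg.pair (.const 0)) hs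
    ((hg.sz_bd.add (((PolyBd.const 4).mul (hl.add hg.sz_bd)).add (.const 1))).add (.const 1))
    fun c l₁ l₂ h => sz_mulStep_le _ _ l₁ l₂ h)).congr fun c => ?_
  rw [foldl_mulStep, List.reverse_reverse, ofBits_bits]

/-- One digit of a comparison. The state consists of the remaining digits of the second number and
of the result of the comparison of the digits read so far. -/
def ltStep (s : ℕ × Bool) (b : Bool) : ℕ × Bool :=
  (s.1.div2, if xor b s.1.bodd then s.1.bodd else s.2)

/-- The first number is smaller if the second one has a nonzero rest beyond the digits of the first,
or if the comparison of the digits that were read says so. -/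
theorem foldl_ltStep (l : List Bool) (s : ℕ × Bool) :
    (0 < (l.foldl ltStep s).1 ∨ (l.foldl ltStep s).2 = true) ↔
      (ofBits l < s.1 ∨ ofBits l = s.1 ∧ s.2 = true) := by
  induction l generalizing s with
  | nil =>
    obtain ⟨n, r⟩ := s
    cases r <;> simp [ofBits]
    omega
  | cons b l ih =>
    obtain ⟨n, r⟩ := s
    rw [List.foldl_cons, ih]
    change (_ ↔ Nat.bit b (ofBits l) < n ∨ Nat.bit b (ofBits l) = n ∧ r = true)
    have h := Nat.bodd_add_div2 n
    simp only [ltStep]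
    generalize ofBits l = v, n.div2 = d at h ⊢
    cases hn : n.bodd <;> cases b <;> cases r <;> simp [Nat.bit, hn] at h ⊢ <;> omega

theorem FP.lt {f g : γ → ℕ} (hf : FP f) (hg : FP g) : FP fun c => decide (f c < g c) := by
  have hx : FP fun p : γ × Bool × (ℕ × Bool) => p.2.2.1.bodd :=
    (FP.fst.comp (FP.snd.comp .snd)).bodd
  have h : FP fun c => (f c).bits.foldl ltStep (g c, false) := by
    refine FP.foldl hf.bits (hg.pair (.const false)) (f := fun _ => ltStep)
      ((FP.fst.comp (FP.snd.comp .snd)).div2.pair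
        (((FP.fst.comp .snd).xor hx).ite hx (FP.snd.comp (FP.snd.comp .snd))))
      (B := fun _ => 2) (.const 2) fun _ s b => ?_
    obtain ⟨n, r⟩ := s
    simp only [ltStep, sz_pair]
    have := sz_div2_le n
    have := sz_bool_le (if Bool.xor b n.bodd then n.bodd else r)
    have := sz_pos r
    omega
  refine ((FP.fst.comp h).isZero.ite (FP.snd.comp h) (.const true)).congr fun c => ?_
  have h1 := CakeCutting.foldl_ltStep (f c).bits (g c, false)
  rw [ofBits_bits] at h1
  generalize (f c).bits.foldl ltStep (g c, false) = s at h1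
  obtain ⟨n, r⟩ := s
  rw [Bool.eq_iff_iff]
  simp at h1 ⊢
  rw [← h1]
  by_cases hn : n = 0
  · simp [hn]
  · simp [hn, Nat.pos_of_ne_zero hn]

end Arithmetic

/-! ### Words as data -/

/-- A symbol is represented like an element of `Option (Option Bool)`. -/
instance : Enc Sym := ⟨fun
  | .close => enc (none : Option (Option Bool))
  | .item => enc (some none : Option (Option Bool))
  | .bit b => enc (some (some b) : Option (Option Bool))⟩

/-- The symbol as an element of `Option (Option Bool)`. -/
def Sym.toOption : Sym → Option (Option Bool)
  | .close => none
  | .item => some none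
  | .bit b => some (some b)

instance : Enc Frac := ⟨fun q => enc (q.num, q.den)⟩

instance : Enc PricedInterval :=
  ⟨fun P => enc (P.left, P.right, P.leftClosed, P.rightClosed, P.density)⟩

/-- Turn a word on the stack `a` into a list of symbols on the main stack. -/
def readInput : Prog :=
  .seq (flush .a [.b]) (.seq (.push .main .close) (.loop .b Option.isSome
    (.seq
      (.ite .b (fun s => s = some .close) (pushWordProg (wd Sym.close))
      (.ite .b (fun s => s = some .item) (pushWordProg (wd Sym.item))
      (.ite .b (fun s => s = some (.bit true)) (pushWordProg (wd (Sym.bit true)))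
        (pushWordProg (wd (Sym.bit false))))))
      (.seq (.push .main .item) (.move .b [])))))

theorem exec_pushWd (s : Sym) (m x y z : List Sym) :
    Exec (pushWordProg (wd s)) (Mem.mk m [] x y z) (Mem.mk (wd s ++ m) [] x y z) 10 := by
  refine (exec_pushWordProg (wd s) m [] x y z .skip _ 1 (.skip _)).weaken ?_
  rcases s with b | _ | _
  · cases b <;> decide
  · decide
  · decide

theorem exec_readInput (w : List Sym) :
    Exec readInput (Mem.mk [] [] w [] []) (mem (wd w)) (20 * w.length + 10) := by
  have loop : ∀ (w v : List Sym), Exec (.loop .b Option.isSome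
    (.seq
      (.ite .b (fun s => s = some .close) (pushWordProg (wd Sym.close))
      (.ite .b (fun s => s = some .item) (pushWordProg (wd Sym.item))
      (.ite .b (fun s => s = some (.bit true)) (pushWordProg (wd (Sym.bit true)))
        (pushWordProg (wd (Sym.bit false))))))
      (.seq (.push .main .item) (.move .b [])))) (Mem.mk (wd v) [] [] w [])
      (mem (wd (w.reverse ++ v))) (18 * w.length + 1) := by
    intro w
    induction w with
    | nil => exact fun v => (Exec.loop_false rfl).weaken (by simp)
    | cons s w ih =>
      intro v
      refine (Exec.loop_true (t := 13 + (1 + 1)) rfl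
        (.seq (S' := Mem.mk (wd s ++ wd v) [] [] (s :: w) []) ?_
        (.seq (.push' (S' := Mem.mk (wd (s :: v)) [] [] (s :: w) []) (by simp; rfl))
        (.move' (S' := Mem.mk (wd (s :: v)) [] [] w []) s w rfl (by simp [Mem.pushAll]))))
        (ih (s :: v))).cast (by simp) (by simp; omega)
      rcases s with b | _ | _
      · cases b
        · exact .ite_false rfl (.ite_false rfl (.ite_false rfl (exec_pushWd _ _ _ _ _)))
        · exact .ite_false rfl (.ite_false rfl (.ite_true rfl (exec_pushWd _ _ _ _ _)))
      · exact (Exec.ite_false rfl (.ite_true rfl (exec_pushWd _ _ _ _ _))).weaken (by omega)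
      · exact (Exec.ite_true rfl (exec_pushWd _ _ _ _ _)).weaken (by omega)
  refine (Exec.seq (exec_flush (by decide) _) (.seq
    (.push' (S' := Mem.mk (wd ([] : List Sym)) [] [] w.reverse []) ?_) (loop _ []))).cast ?_ ?_
  · simp; rfl
  · simp
  · simp; omega

/-- Pop a symbol from the main stack. -/
def popMain : Prog := .move .main []

/-- Turn a list of symbols on the main stack into a word on the stack `a`. The tests decode the
representation of a single symbol. -/
def writeOutput : Prog :=
  .seq (.loop .main (fun s => s = some .item)
    (.seq popMain (.ite .main (fun s => s = some .item)
      (.seq popMain (.seq popMain (.ite .main (fun s => s = some .item)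
        (.seq popMain (.seq popMain (.ite .main (fun s => s = some .item)
          (.seq popMain (.seq popMain (.seq popMain (.push .b (.bit true)))))
          (.seq popMain (.push .b (.bit false))))))
        (.seq popMain (.push .b .item)))))
      (.seq popMain (.push .b .close)))))
  (.seq popMain (flush .b [.a]))

theorem exec_popMain (s : Sym) (m x y z : List Sym) :
    Exec popMain (Mem.mk (s :: m) [] x y z) (Mem.mk m [] x y z) 1 :=
  .move' s m rfl (by simp [Mem.pushAll])

theorem exec_push_b (s : Sym) (m x y z : List Sym) :
    Exec (.push .b s) (Mem.mk m [] x y z) (Mem.mk m [] x (s :: y) z) 1 :=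
  .push' (by simp)

theorem exec_writeOutput (w : List Sym) :
    Exec writeOutput (mem (wd w)) (Mem.mk [] [] w [] []) (30 * w.length + 10) := by
  have loop : ∀ (w v : List Sym) , Exec (.loop .main (fun s => s = some .item)
    (.seq popMain (.ite .main (fun s => s = some .item)
      (.seq popMain (.seq popMain (.ite .main (fun s => s = some .item)
        (.seq popMain (.seq popMain (.ite .main (fun s => s = some .item)
          (.seq popMain (.seq popMain (.seq popMain (.push .b (.bit true)))))
          (.seq popMain (.push .b (.bit false))))))
        (.seq popMain (.push .b .item)))))
      (.seq popMain (.push .b .close))))) (Mem.mk (wd w) [] [] v [])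
      (Mem.mk [.close] [] [] (w.reverse ++ v) []) (20 * w.length + 1) := by
    intro w
    induction w with
    | nil => exact fun v => (Exec.loop_false rfl).weaken (by simp)
    | cons s w ih =>
      intro v
      refine (Exec.loop_true (t := 19) rfl (S' := Mem.mk (wd w) [] [] (s :: v) []) ?_ (ih _)).cast
        (by simp) (by simp; omega)
      refine (Exec.seq (t' := 18) (exec_popMain _ (wd s ++ wd w) _ _ _) ?_).weaken (by omega)
      rcases s with b | _ | _
      · refine (Exec.ite_true rfl (.seq (exec_popMain _ _ _ _ _) (.seq (exec_popMain _ _ _ _ _)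
          (.ite_true rfl (.seq (exec_popMain _ _ _ _ _) (.seq (t' := 6) (exec_popMain _ _ _ _ _)
          ?_)))))).weaken (t := 12) (by omega)
        cases b
        · exact (Exec.ite_false rfl (.seq (exec_popMain _ _ _ _ _)
            (exec_push_b _ _ _ _ _))).weaken (by omega)
        · exact (Exec.ite_true rfl (.seq (exec_popMain _ _ _ _ _) (.seq (exec_popMain _ _ _ _ _)
            (.seq (exec_popMain _ _ _ _ _) (exec_push_b _ _ _ _ _))))).weaken (by omega)
      · exact (Exec.ite_true rfl (.seq (exec_popMain _ _ _ _ _) (.seq (exec_popMain _ _ _ _ _)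
          (.ite_false rfl (.seq (exec_popMain _ _ _ _ _) (exec_push_b _ _ _ _ _)))))).weaken
          (by omega)
      · exact (Exec.ite_false rfl (.seq (exec_popMain _ _ _ _ _)
          (exec_push_b _ _ _ _ _))).weaken (by omega)
  refine (Exec.seq (loop w []) (.seq (exec_popMain _ _ _ _ _)
    (exec_flush (by decide) _))).cast ?_ ?_
  · simp
  · simp; omega

/-- A feasible function on words gives a Turing machine with polynomial running time. -/
theorem FP.computableInPolyTime {α β : Type} (ea : α → List Sym) (eb : β → List Sym) (f : α → β)
    {g : List Sym → List Sym} (hg : FP g) (h : ∀ x, g (ea x) = eb (f x)) :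
    Nonempty (TM2ComputableInPolyTime ea eb f) := by
  obtain ⟨p, k, hp⟩ := hg
  have hsz : ∀ w : List Sym, sz w ≤ 9 * w.length + 1 := fun w => by
    induction w with
    | nil => simp
    | cons s w ih =>
      have : sz s ≤ 7 := by
        rcases s with b | _ | _
        · cases b <;> decide
        · decide
        · decide
      simp only [sz_cons, List.length_cons]; omega
  have hB : ∀ l : ℕ, ∃ m, ∀ n : ℕ,
      20 * n + 10 + ((9 * n + 3) ^ l + (30 * (9 * n + 3) ^ l + 10)) ≤ (n + 2) ^ m := by
    intro l
    refine ⟨6 + 4 * l, fun n => ?_⟩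
    have h1 : 9 * n + 3 ≤ (n + 2) ^ 4 := by
      have : (2:ℕ) ^ 3 ≤ (n + 2) ^ 3 := Nat.pow_le_pow_left (by omega) 3
      rw [pow_succ]
      nlinarith [sq_nonneg n]
    have h2 : (9 * n + 3) ^ l ≤ (n + 2) ^ (4 * l) := by
      rw [pow_mul]; exact Nat.pow_le_pow_left h1 l
    have h3 : 1 ≤ (n + 2) ^ (4 * l) := Nat.one_le_pow _ _ (by omega)
    have h4 : 20 * n + 51 ≤ (n + 2) ^ 6 := by
      have : (2:ℕ) ^ 5 ≤ (n + 2) ^ 5 := Nat.pow_le_pow_left (by omega) 5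
      rw [pow_succ]
      nlinarith
    rw [pow_add]
    nlinarith
  obtain ⟨m, hm⟩ := hB k
  refine Prog.computableInPolyTime ea eb f (.seq readInput (.seq p writeOutput)) m fun x => ?_
  have h1 := hp (ea x)
  have h2 := h1.2 []
  simp only [List.append_nil, h] at h2
  refine (Exec.seq (exec_readInput _) (.seq h2 (exec_writeOutput _))).weaken ((hm _).trans' ?_)
  have h3 : (sz (ea x) + 2) ^ k ≤ (9 * (ea x).length + 3) ^ k :=
    Nat.pow_le_pow_left (by have := hsz (ea x); omega) k
  have h4 := (length_lt_sz (g (ea x))).le.trans h1.1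
  rw [h] at h4
  omega

/-! ### The algorithm -/

/-- The state of the parser: whether the list of some agent is being read; one item for each number
of the current interval that is still to be read; the digits of the current number read so far; the
numbers of the current agent read so far; the numbers of the previous agents. Everything is in
reverse order, so that numbers have their most significant digit first. -/
abbrev ParseState : Type :=
  Bool × List Unit × List Bool × List (List Bool) × List (List (List Bool))

/-- One step of the parser. While numbers are expected, a bit is a digit and `close` ends a number;
otherwise `item` starts an agent or an interval, and `close` ends an agent. Malformed input is
handled arbitrarily. -/
def parseStep (s : ParseState) (x : Sym) : ParseState :=
  match s.2.1 with
  | [] => match x.toOption with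
    | none => if s.1 then (false, [], [], [], s.2.2.2.1 :: s.2.2.2.2) else s
    | some none => if s.1 then (s.1, [(), (), (), ()], s.2.2) else (true, [], s.2.2)
    | some (some _) => s
  | _ :: cnt => match x.toOption with
    | none => (s.1, cnt, [], s.2.2.1 :: s.2.2.2.1, s.2.2.2.2)
    | some none => s
    | some (some b) => (s.1, s.2.1, b :: s.2.2.1, s.2.2.2)

/-- The agents' lists of numbers. Each of these lists, and the digits of each number, are in reverse
order. -/
def parse (w : List Sym) : List (List (List Bool)) :=
  (w.foldl parseStep (false, [], [], [], [])).2.2.2.2.reverse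

/-- The fraction `a / b`, or zero if `b = 0`. -/
def mkFrac (a b : ℕ) : Frac :=
  if h : b = 0 then ⟨0, 1, one_pos⟩ else ⟨a, b, Nat.pos_of_ne_zero h⟩

/-- Comparison of fractions by cross multiplication. -/
def Frac.lt (p q : Frac) : Bool := decide (p.num * q.den < q.num * p.den)

/-- Whether two fractions denote the same number. -/
def Frac.same (p q : Frac) : Bool := !p.lt q && !q.lt p

/-- The sum of `q` and `1 / N`. -/
def Frac.shift (q : Frac) (N : ℕ) : Frac := mkFrac (q.num * N + q.den) (q.den * N)

/-- The left endpoint of the first interval of an agent, from the agent's list of numbers. -/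
def firstPoint (l : List (List Bool)) : Option Frac :=
  match l.reverse with
  | [] => none
  | a :: l => match l with
    | [] => none
    | b :: _ => some (mkFrac (appendBits 0 a) (appendBits 0 b))

/-- Whether `o` is the point `q`. -/
def isPoint (q : Frac) (o : Option Frac) : Bool :=
  match o with
  | none => false
  | some r => q.same r

/-- Prepend `o`, unless it is a point that is already in the list; then prepend `none`. -/
def addPoint (l : List (Option Frac)) (o : Option Frac) : List (Option Frac) :=
  (match o with
    | none => none
    | some q => if l.any (isPoint q) then none else some q) :: l

/-- Keep only the first occurrence of each point. -/
def dedupPoints (l : List (Option Frac)) : List (Option Frac) := (l.foldl addPoint []).reverse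

/-- The smallest point that satisfies `c`, or `1` if there is none. -/
def minPoint (c : Frac → Bool) (l : List Frac) : Frac :=
  l.foldl (fun m q => if c q && q.lt m then q else m) ⟨1, 1, one_pos⟩

/-- The gap between the atom at `q` and the next atom. -/
def gapAfter (N : ℕ) (l : List Frac) (q : Frac) : PricedInterval :=
  ⟨q.shift N, minPoint q.lt l, true, true, mkFrac 1 N⟩

/-- The complement of all atoms. -/
def gaps (N : ℕ) (l : List Frac) : List PricedInterval :=
  ⟨mkFrac 0 1, minPoint (fun _ => true) l, true, true, mkFrac 1 N⟩ :: l.map (gapAfter N l)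

/-- The atom at `q`: an open interval of length `1 / N` and of price `1`. -/
def atom (N : ℕ) (o : Option Frac) : List PricedInterval :=
  match o with
  | none => []
  | some q => [⟨q, q.shift N, false, false, mkFrac N 1⟩]

/-- The number of cells into which the cake is divided: `4 ^ w.length`. -/
def cells (w : List Sym) : ℕ := w.foldl (fun n _ => Nat.bit false (Nat.bit false n)) 1

/-- The points at which the agents, except for the first one, get their atoms. -/
def owned (w : List Sym) : List (Option Frac) := dedupPoints ((parse w).map firstPoint).tail

/-- The solution of the instance that is encoded by `w`: the first agent gets the gaps, every other
agent the atom at its own point, if it has one. -/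
def solve (w : List Sym) : Output :=
  gaps (cells w) ((owned w).flatMap Option.toList) :: (owned w).map (atom (cells w))

/-! ### The algorithm is feasible -/

section Feasible

variable {γ β α : Type} [Enc γ] [Enc β] [Enc α]

theorem FP.toOption {f : γ → Sym} (hf : FP f) : FP fun c => (f c).toOption :=
  hf.of_enc_eq fun c => by cases f c <;> rfl

theorem FP.sym_cases {s : γ → Sym} (hs : FP s) {f g : γ → β} (hf : FP f) (hg : FP g)
    {h : γ → Bool → β} (hh : FP fun p : γ × Bool => h p.1 p.2) :
    FP fun c => match (s c).toOption with
      | none => f c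
      | some none => g c
      | some (some b) => h c b := by
  refine (hs.toOption.option_cases hf (g := fun c o => match o with
    | none => g c
    | some b => h c b) ((FP.option_cases .snd (hg.comp .fst) (g := fun p b => h p.1 b)
      (hh.comp ((FP.fst.comp .fst).pair .snd))).congr fun p => by
        rcases p with ⟨c, _ | b⟩ <;> rfl)).congr fun c => ?_
  rcases (s c).toOption with _ | _ | _ <;> rfl

theorem FP.parseStep {f : γ → ParseState} {x : γ → Sym} (hf : FP f) (hx : FP x) :
    FP fun c => parseStep (f c) (x c) := by
  have h1 : FP fun c => (f c).1 := FP.fst.comp hf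
  have h2 : FP fun c => (f c).2.1 := FP.fst.comp (FP.snd.comp hf)
  have h2' : FP fun c => (f c).2.2 := FP.snd.comp (FP.snd.comp hf)
  have h3 : FP fun c => (f c).2.2.1 := FP.fst.comp h2'
  have h4' : FP fun c => (f c).2.2.2 := FP.snd.comp h2'
  have h4 : FP fun c => (f c).2.2.2.1 := FP.fst.comp h4'
  have h5 : FP fun c => (f c).2.2.2.2 := FP.snd.comp h4'
  refine (h2.list_cases (hx.sym_cases
      (f := fun c => if (f c).1 then (false, [], [], [], (f c).2.2.2.1 :: (f c).2.2.2.2) else f c)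
      (h1.ite ((FP.const false).pair ((FP.const []).pair ((FP.const []).pair ((FP.const []).pair
        (h4.cons h5))))) hf)
      (g := fun c => if (f c).1 then ((f c).1, [(), (), (), ()], (f c).2.2)
        else (true, [], (f c).2.2))
      (h1.ite (h1.pair ((FP.const _).pair h2')) ((FP.const _).pair ((FP.const _).pair h2')))
      (h := fun c _ => f c) (hf.comp .fst))
    (g := fun c _ cnt => match (x c).toOption with
      | none => ((f c).1, cnt, [], (f c).2.2.1 :: (f c).2.2.2.1, (f c).2.2.2.2)
      | some none => f c
      | some (some b) => ((f c).1, (f c).2.1, b :: (f c).2.2.1, (f c).2.2.2))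
    (FP.sym_cases (hx.comp .fst)
      (f := fun p : γ × Unit × List Unit =>
        ((f p.1).1, p.2.2, [], (f p.1).2.2.1 :: (f p.1).2.2.2.1, (f p.1).2.2.2.2))
      ((h1.comp .fst).pair ((FP.snd.comp .snd).pair ((FP.const []).pair
        (((h3.cons h4).comp .fst).pair (h5.comp .fst)))))
      (g := fun p : γ × Unit × List Unit => f p.1) (hf.comp .fst)
      (h := fun (p : γ × Unit × List Unit) b =>
        ((f p.1).1, (f p.1).2.1, b :: (f p.1).2.2.1, (f p.1).2.2.2))
      ((h1.comp (FP.fst.comp .fst)).pair ((h2.comp (FP.fst.comp .fst)).pair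
        ((FP.snd.cons (h3.comp (FP.fst.comp .fst))).pair
          (h4'.comp (FP.fst.comp .fst))))))).congr fun c => ?_
  rw [CakeCutting.parseStep]
  rcases (f c).2.1 with _ | ⟨u, cnt⟩ <;> rfl

theorem sz_parseStep_le (s : ParseState) (x : Sym) : sz (parseStep s x) ≤ sz s + 12 := by
  obtain ⟨i, cnt, cur, nums, out⟩ := s
  have h1 := sz_bool_le false
  have h2 := sz_bool_le true
  have h3 := sz_pos i
  have h4 := sz_pos cnt
  have h5 := sz_pos cur
  have h6 := sz_pos nums
  unfold parseStep
  rcases cnt with _ | ⟨u, cnt⟩ <;> rcases x.toOption with _ | _ | b <;> cases i <;> simp at * <;>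
    first
    | omega
    | (have := sz_bool_le b; omega)

theorem FP.parse {f : γ → List Sym} (hf : FP f) : FP fun c => parse (f c) := by
  refine FP.reverse (FP.snd.comp (FP.snd.comp (FP.snd.comp (FP.snd.comp (?_ : FP fun c =>
    (f c).foldl CakeCutting.parseStep (false, [], [], [], []))))))
  exact FP.foldl hf (.const _) (f := fun _ => CakeCutting.parseStep)
    (FP.parseStep (FP.snd.comp .snd) (FP.fst.comp .snd)) (B := fun _ => 12) (.const 12)
    fun _ _ _ => sz_parseStep_le _ _

theorem FP.num {f : γ → Frac} (hf : FP f) : FP fun c => (f c).num :=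
  FP.fst.comp (hf.of_enc_eq (g := fun c => ((f c).num, (f c).den)) fun _ => rfl)

theorem FP.den {f : γ → Frac} (hf : FP f) : FP fun c => (f c).den :=
  FP.snd.comp (hf.of_enc_eq (g := fun c => ((f c).num, (f c).den)) fun _ => rfl)

theorem FP.mkFrac {f g : γ → ℕ} (hf : FP f) (hg : FP g) : FP fun c => mkFrac (f c) (g c) := by
  refine (hg.isZero.ite (.const (0, 1)) (hf.pair hg)).of_enc_eq fun c => ?_
  unfold CakeCutting.mkFrac
  by_cases h : g c = 0
  · simp only [h]; rfl
  · simp only [h]; rfl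

theorem FP.fracLt {f g : γ → Frac} (hf : FP f) (hg : FP g) : FP fun c => (f c).lt (g c) :=
  (hf.num.mul hg.den).lt (hg.num.mul hf.den)

theorem FP.same {f g : γ → Frac} (hf : FP f) (hg : FP g) : FP fun c => (f c).same (g c) :=
  (hf.fracLt hg).not.and (hg.fracLt hf).not

theorem FP.shift {f : γ → Frac} {N : γ → ℕ} (hf : FP f) (hN : FP N) :
    FP fun c => (f c).shift (N c) :=
  ((hf.num.mul hN).add hf.den).mkFrac (hf.den.mul hN)

theorem FP.firstPoint {f : γ → List (List Bool)} (hf : FP f) : FP fun c => firstPoint (f c) := by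
  refine (hf.reverse.list_cases (.const none) (g := fun _ a l => match l with
    | [] => none
    | b :: _ => some (CakeCutting.mkFrac (CakeCutting.appendBits 0 a) (CakeCutting.appendBits 0 b)))
    ((FP.list_cases (FP.snd.comp .snd) (.const none)
      (g := fun p b _ => some (CakeCutting.mkFrac (CakeCutting.appendBits 0 p.2.1)
        (CakeCutting.appendBits 0 b))) (FP.optionSome (FP.mkFrac
          (FP.appendBits (.const 0) (FP.fst.comp (FP.snd.comp .fst)))
          (FP.appendBits (.const 0) (FP.fst.comp .snd))))).congr fun p => by
            rcases p with ⟨c, a, _ | ⟨b, l⟩⟩ <;> rfl)).congr fun c => ?_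
  rw [CakeCutting.firstPoint]
  rcases (f c).reverse with _ | ⟨a, l⟩ <;> rfl

theorem FP.isPoint {f : γ → Frac} {g : γ → Option Frac} (hf : FP f) (hg : FP g) :
    FP fun c => isPoint (f c) (g c) :=
  (hg.option_cases (.const false) (g := fun c r => (f c).same r)
    ((hf.comp .fst).same .snd)).congr fun c => by cases g c <;> rfl

theorem FP.addPoint {f : γ → List (Option Frac)} {g : γ → Option Frac} (hf : FP f) (hg : FP g) :
    FP fun c => addPoint (f c) (g c) :=
  (FP.cons (hg.option_cases (.const none)
    (g := fun c q => if (f c).any (CakeCutting.isPoint q) then none else some q)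
    ((FP.any (hf.comp .fst) (g := fun p o => CakeCutting.isPoint p.2 o)
      (FP.isPoint (FP.snd.comp .fst) .snd)).ite (.const none) (.optionSome .snd))) hf).congr
      fun c => by
        unfold CakeCutting.addPoint; cases g c <;> rfl

theorem FP.dedupPoints {f : γ → List (Option Frac)} (hf : FP f) :
    FP fun c => dedupPoints (f c) := by
  refine FP.reverse (FP.foldl hf (.const []) (f := fun _ => CakeCutting.addPoint)
    (FP.addPoint (FP.snd.comp .snd) (FP.fst.comp .snd)) (B := fun p => sz p) .sz fun c l o => ?_)
  have : sz (match o with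
    | none => none
    | some q => if l.any (CakeCutting.isPoint q) then none else some q) ≤ sz o := by
    rcases o with _ | q
    · exact le_rfl
    · dsimp only
      split_ifs
      · exact sz_pos _
      · exact le_rfl
  rw [sz_pair]
  refine (sz_cons _ _).le.trans ?_
  omega

theorem FP.minPoint {L : γ → List Frac} {p : γ → Frac → Bool} (hL : FP L)
    (hp : FP fun x : γ × Frac => p x.1 x.2) : FP fun c => minPoint (p c) (L c) := by
  refine FP.foldl hL (.const _) (f := fun c m q => if p c q && q.lt m then q else m)
    (((hp.comp (FP.fst.pair (FP.fst.comp .snd))).and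
      ((FP.fst.comp .snd).fracLt (FP.snd.comp .snd))).ite (FP.fst.comp .snd) (FP.snd.comp .snd))
    (B := fun p => sz p) .sz fun c m q => ?_
  rw [sz_pair]
  split_ifs <;> omega

theorem FP.pricedInterval {l r d : γ → Frac} {i j : γ → Bool} (hl : FP l) (hr : FP r) (hi : FP i)
    (hj : FP j) (hd : FP d) : FP fun c => (⟨l c, r c, i c, j c, d c⟩ : PricedInterval) :=
  (hl.pair (hr.pair (hi.pair (hj.pair hd)))).of_enc_eq fun _ => rfl

theorem FP.gapAfter {N : γ → ℕ} {L : γ → List Frac} {q : γ → Frac} (hN : FP N) (hL : FP L)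
    (hq : FP q) : FP fun c => gapAfter (N c) (L c) (q c) :=
  have h : FP fun x : γ × Frac => (q x.1).lt x.2 := .fracLt (hq.comp .fst) .snd
  .pricedInterval (.shift hq hN) (.minPoint hL (p := fun c => (q c).lt) h) (.const true)
    (.const true) (.mkFrac (.const 1) hN)

theorem FP.gaps {N : γ → ℕ} {L : γ → List Frac} (hN : FP N) (hL : FP L) :
    FP fun c => gaps (N c) (L c) :=
  have h : FP fun c => CakeCutting.minPoint (fun _ => true) (L c) :=
    .minPoint hL (p := fun _ _ => true) (.const true)
  have h' : FP fun x : γ × Frac => CakeCutting.gapAfter (N x.1) (L x.1) x.2 :=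
    .gapAfter (hN.comp .fst) (hL.comp .fst) .snd
  .cons (.pricedInterval (.const _) h (.const true) (.const true) (.mkFrac (.const 1) hN))
    (hL.map h')

theorem FP.atom {N : γ → ℕ} {o : γ → Option Frac} (hN : FP N) (ho : FP o) :
    FP fun c => atom (N c) (o c) := by
  have h : FP fun p : γ × Frac => [(⟨p.2, p.2.shift (N p.1), false, false,
      CakeCutting.mkFrac (N p.1) 1⟩ : PricedInterval)] :=
    .cons (.pricedInterval .snd (.shift .snd (hN.comp .fst)) (.const false) (.const false)
      (.mkFrac (hN.comp .fst) (.const 1))) (.const [])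
  refine (ho.option_cases (.const []) (g := fun c q => [(⟨q, q.shift (N c), false, false,
      CakeCutting.mkFrac (N c) 1⟩ : PricedInterval)]) h).congr fun c => ?_
  unfold CakeCutting.atom
  cases o c <;> rfl

theorem FP.cells {f : γ → List Sym} (hf : FP f) : FP fun c => cells (f c) := by
  refine FP.foldl hf (.const 1) (f := fun _ n _ => Nat.bit false (Nat.bit false n))
    (.bit (.const false) (.bit (.const false) (FP.snd.comp .snd))) (B := fun _ => 8) (.const 8)
    fun _ n _ => ?_
  have := sz_bit_le false (Nat.bit false n)
  have := sz_bit_le false n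
  have := sz_bool_le false
  omega

theorem FP.owned {f : γ → List Sym} (hf : FP f) : FP fun c => owned (f c) :=
  .dedupPoints (.tail (hf.parse.map (g := fun _ => CakeCutting.firstPoint) (.firstPoint .snd)))

theorem FP.toList {f : γ → Option α} (hf : FP f) : FP fun c => (f c).toList :=
  (hf.option_cases (.const []) (g := fun _ a => [a]) (.cons .snd (.const []))).congr fun c => by
    cases f c <;> rfl

theorem FP.solve {f : γ → List Sym} (hf : FP f) : FP fun c => solve (f c) :=
  .cons (.gaps hf.cells (hf.owned.flatMap (g := fun _ => Option.toList) (.toList .snd)))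
    (hf.owned.map (g := fun c => CakeCutting.atom (CakeCutting.cells (f c)))
      (.atom (hf.cells.comp .fst) .snd))

theorem FP.symBit {f : γ → Bool} (hf : FP f) : FP fun c => Sym.bit (f c) :=
  hf.optionSome.optionSome.of_enc_eq fun _ => rfl

theorem FP.encodeNat {f : γ → ℕ} (hf : FP f) : FP fun c => encodeNat (f c) :=
  (hf.bits.map (g := fun _ => Sym.bit) (.symBit .snd)).append (.const _)

theorem FP.encodeFrac {f : γ → Frac} (hf : FP f) : FP fun c => encodeFrac (f c) :=
  hf.num.encodeNat.append hf.den.encodeNat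

theorem FP.encodeList {e : α → List Sym} (he : FP e) {f : γ → List α} (hf : FP f) :
    FP fun c => encodeList e (f c) :=
  (hf.flatMap (g := fun _ a => Sym.item :: e a) (.cons (.const _) (he.comp .snd))).append (.const _)

theorem FP.encodePricedInterval : FP encodePricedInterval := by
  have h : FP fun P : PricedInterval =>
      (P.left, P.right, P.leftClosed, P.rightClosed, P.density) := .retype fun _ => rfl
  have h2 := FP.snd.comp h
  have h3 := FP.snd.comp h2
  have h4 := FP.snd.comp h3
  exact ((((FP.fst.comp h).encodeFrac.append (FP.fst.comp h2).encodeFrac).append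
    ((FP.fst.comp h3).symBit.cons ((FP.fst.comp h4).symBit.cons (.const [])))).append
      (FP.snd.comp h4).encodeFrac)

theorem FP.encodeOutput_solve : FP fun w => encodeOutput (CakeCutting.solve w) :=
  FP.encodeList (FP.encodePricedInterval.encodeList .id) FP.id.solve

end Feasible

/-- The solution of an instance. -/
def solution (I : Instance) : Output := solve (encodeInstance I)

theorem computableInPolyTime_solution :
    Nonempty (TM2ComputableInPolyTime encodeInstance encodeOutput solution) :=
  FP.encodeOutput_solve.computableInPolyTime _ _ _ fun _ => rfl

/-! ### A sufficient condition for a CAEI -/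

theorem IsPriceDensity.bundlePrice_mono {p : ℝ → ℝ} (hp : IsPriceDensity p) {S T : Set ℝ}
    (hT : T ⊆ cake) (hST : S ⊆ T) (hTm : MeasurableSet T) : bundlePrice p S ≤ bundlePrice p T :=
  setIntegral_mono_set (hp.integrable.mono_set hT)
    ((ae_restrict_iff' hTm).2 (.of_forall fun t ht => hp.nonneg t (hT ht))) hST.eventuallyLE

/-- An atom of price `1` together with a stretch of positive density is not affordable. -/
theorem one_lt_bundlePrice {p : ℝ → ℝ} (hp : IsPriceDensity p) {q δ r : ℝ} (hδ : 0 < δ)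
    (h1 : bundlePrice p (Ioo q (q + δ)) = 1) (hr : q + δ < r) (hsub : Icc q r ⊆ cake)
    (pos : ∀ t ∈ Ioo (q + δ) r, 0 < p t) : 1 < bundlePrice p (Icc q r) := by
  have hs : Ioc (q + δ) r ⊆ Icc q r := fun t ht => ⟨by linarith [ht.1], ht.2⟩
  have hs' : Ioo q (q + δ) ⊆ Icc q r := fun t ht => ⟨ht.1.le, by linarith [ht.2]⟩
  have h2 : 0 < bundlePrice p (Ioc (q + δ) r) := by
    rw [bundlePrice, ← intervalIntegral.integral_of_le hr.le]
    exact intervalIntegral.intervalIntegral_pos_of_pos_on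
      ((intervalIntegrable_iff_integrableOn_Ioc_of_le hr.le).2
        (hp.integrable.mono_set (hs.trans hsub))) pos hr
  have h3 : bundlePrice p (Ioo q (q + δ) ∪ Ioc (q + δ) r) =
      bundlePrice p (Ioo q (q + δ)) + bundlePrice p (Ioc (q + δ) r) :=
    setIntegral_union (disjoint_left.2 fun t h h' => absurd h.2 (not_lt.2 h'.1.le))
      measurableSet_Ioc (hp.integrable.mono_set (hs'.trans hsub))
      (hp.integrable.mono_set (hs.trans hsub))
  have h4 := hp.bundlePrice_mono hsub (union_subset hs' hs) measurableSet_Icc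
  linarith

/-- Agent `o` gets the whole cake, except for a small atom `(q, q + δ)` for each `q ∈ P`. The atoms
cost one unit each and go to different agents, and the demand set of each other agent contains a
whole atom, so that it is too expensive. The separation of the endpoints ensures that the demand set
of agent `o` contains a whole atom, too, unless it is disjoint from all of them. -/
theorem isCAEI_of_atoms {n : ℕ} {D x : Fin n → Set ℝ} {F : Fin n → Set (ℝ × ℝ)} {p : ℝ → ℝ}
    {o : Fin n} {P E : Set ℝ} {δ : ℝ} (hδ : 0 < δ)
    (hD : ∀ i, D i = ⋃ J ∈ F i, Icc J.1 J.2)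
    (hF : ∀ i, ∀ J ∈ F i, 0 ≤ J.1 ∧ J.1 < J.2 ∧ J.2 ≤ 1)
    (hE : ∀ i, ∀ J ∈ F i, J.1 ∈ E ∧ J.2 ∈ E)
    (hsep : ∀ e ∈ E, ∀ e' ∈ E, e < e' → e + δ < e')
    (hP : ∀ q ∈ P, ∃ i, ∃ J ∈ F i, J.1 = q)
    (hlose : ∀ i ≠ o, (F i).Nonempty → ∃ J ∈ F i, J.1 ∈ P)
    (hpiece : ∀ i, IsPiece (x i))
    (hxo : x o = cake \ ⋃ q ∈ P, Ioo q (q + δ))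
    (hx : ∀ i ≠ o, x i = ∅ ∨ ∃ q ∈ P, x i = Ioo q (q + δ))
    (hdisj : ∀ i j, i ≠ j → i ≠ o → j ≠ o → Disjoint (x i) (x j))
    (howned : ∀ q ∈ P, ∃ i ≠ o, x i = Ioo q (q + δ))
    (hpm : Measurable p)
    (hp : ∀ q ∈ P, ∀ t ∈ Ioo q (q + δ), p t = δ⁻¹)
    (hp' : ∀ t ∈ x o, 0 < p t ∧ p t ≤ 1) : IsCAEI D p x := by
  have hatom : ∀ q ∈ P, Ioo q (q + δ) ⊆ cake := fun q hq t ht => by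
    obtain ⟨i, J, hJ, rfl⟩ := hP q hq
    have h1 := hF i J hJ
    have h2 := hsep _ (hE i J hJ).1 _ (hE i J hJ).2 h1.2.1
    exact ⟨by linarith [ht.1], by linarith [ht.2]⟩
  have hpc : ∀ t ∈ cake, 0 < p t ∧ p t ≤ max δ⁻¹ 1 := fun t ht => by
    by_cases h : t ∈ ⋃ q ∈ P, Ioo q (q + δ)
    · obtain ⟨q, hq, hqt⟩ := mem_iUnion₂.1 h
      rw [hp q hq t hqt]
      exact ⟨inv_pos.2 hδ, le_max_left _ _⟩
    · have := hp' t (hxo ▸ ⟨ht, h⟩)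
      exact ⟨this.1, this.2.trans (le_max_right _ _)⟩
  have hdens : IsPriceDensity p := by
    refine ⟨fun t ht => (hpc t ht).1.le, ?_⟩
    refine Measure.integrableOn_of_bounded (M := max δ⁻¹ 1) (by simp [cake])
      hpm.aestronglyMeasurable ((ae_restrict_iff' measurableSet_Icc).2 (.of_forall fun t ht => ?_))
    rw [Real.norm_of_nonneg (hpc t ht).1.le]
    exact (hpc t ht).2
  have hprice : ∀ q ∈ P, bundlePrice p (Ioo q (q + δ)) = 1 := fun q hq => by
    rw [bundlePrice, setIntegral_congr_fun measurableSet_Ioo (hp q hq), setIntegral_const]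
    simp [hδ.le, hδ.ne']
  have hcake : ∀ i, D i ⊆ cake := fun i => by
    rw [hD]
    exact iUnion₂_subset fun J hJ => Icc_subset_Icc (hF i J hJ).1 (hF i J hJ).2.2
  -- A bundle is not affordable if it satisfies a demand that extends beyond both ends of an atom.
  have hexp : ∀ i, ∀ J ∈ F i, ∀ q ∈ P, J.1 ≤ q → q + δ < J.2 → ∀ S ⊆ cake, MeasurableSet S →
      D i ⊆ S → 1 < bundlePrice p S := fun i J hJ q hq h1 h2 S hS hSm hDS => by
    have h3 : Icc q J.2 ⊆ D i := (Icc_subset_Icc_left h1).trans (by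
      rw [hD]; exact subset_biUnion_of_mem (u := fun J : ℝ × ℝ => Icc J.1 J.2) hJ)
    have h4 := h3.trans (hcake i)
    exact (one_lt_bundlePrice hdens hδ (hprice q hq) h2 h4 fun t ht =>
      (hpc t (h4 ⟨by linarith [ht.1], ht.2.le⟩)).1).trans_le
        (hdens.bundlePrice_mono hS (h3.trans hDS) hSm)
  refine ⟨⟨hpiece, fun i j hij => ?_, ?_⟩, hdens, fun i => ?_, fun i S hS hSm hpS => ?_⟩
  · have key : ∀ j ≠ o, Disjoint (x o) (x j) := fun j hj => by
      rw [hxo]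
      rcases hx j hj with h | ⟨q, hq, h⟩
      · rw [h]; exact disjoint_empty _
      · rw [h]
        exact disjoint_sdiff_left.mono_right
          (subset_biUnion_of_mem (u := fun q : ℝ => Ioo q (q + δ)) hq)
    by_cases hi : i = o
    · exact hi ▸ key j fun h => hij (hi.trans h.symm)
    · by_cases hj : j = o
      · exact hj ▸ (key i hi).symm
      · exact hdisj i j hij hi hj
  · refine Subset.antisymm (iUnion_subset fun i => (hpiece i).1) fun t ht => ?_
    by_cases h : t ∈ ⋃ q ∈ P, Ioo q (q + δ)
    · obtain ⟨q, hq, hqt⟩ := mem_iUnion₂.1 h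
      obtain ⟨i, -, hi⟩ := howned q hq
      exact mem_iUnion.2 ⟨i, hi ▸ hqt⟩
    · exact mem_iUnion.2 ⟨o, hxo ▸ ⟨ht, h⟩⟩
  · by_cases hi : i = o
    · subst hi
      have hm : MeasurableSet (x i) := by
        rw [hxo]
        refine measurableSet_Icc.diff (IsOpen.measurableSet ?_)
        exact isOpen_biUnion fun q _ => isOpen_Ioo
      have h1 : bundlePrice p (x i) ≤ ∫ _ in x i, (1 : ℝ) := by
        refine setIntegral_mono_on (hdens.integrable.mono_set (hpiece i).1) ?_ hm
          fun t ht => (hp' t ht).2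
        exact integrableOn_const ((measure_mono (hpiece i).1).trans_lt (by simp [cake])).ne
      have h2 : ∫ _ in x i, (1 : ℝ) ≤ 1 := by
        rw [setIntegral_const, smul_eq_mul, mul_one]
        have : volume.real (x i) ≤ volume.real cake :=
          measureReal_mono (hpiece i).1 (by simp [cake])
        simpa [cake] using this
      exact h1.trans h2
    · rcases hx i hi with h | ⟨q, hq, h⟩
      · simp [bundlePrice, h]
      · rw [h, hprice q hq]
  · unfold utility
    by_cases hDS : D i ⊆ S
    swap
    · rw [if_neg hDS]; split_ifs <;> norm_num
    rw [if_pos hDS]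
    suffices D i ⊆ x i by rw [if_pos this]
    by_cases hi : i = o
    · subst hi
      rw [hxo]
      refine subset_sdiff.2 ⟨hcake i, ?_⟩
      rw [hD, disjoint_iUnion₂_left]
      intro J hJ
      rw [disjoint_iUnion₂_right]
      intro q hq
      rw [disjoint_left]
      intro t ht htq
      obtain ⟨j, K, hK, rfl⟩ := hP q hq
      have h1 : J.1 ≤ K.1 := by
        by_contra! h
        have := hsep _ (hE j K hK).1 _ (hE i J hJ).1 h
        linarith [ht.1, htq.2]
      have h2 : K.1 + δ < J.2 :=
        hsep _ (hE j K hK).1 _ (hE i J hJ).2 (htq.1.trans_le ht.2)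
      exact absurd hpS (not_le.2 (hexp i J hJ _ hq h1 h2 S hS hSm hDS))
    · rcases (F i).eq_empty_or_nonempty with h | h
      · rw [hD, h]; simp
      · obtain ⟨J, hJ, hJP⟩ := hlose i hi h
        have h2 := hsep _ (hE i J hJ).1 _ (hE i J hJ).2 (hF i J hJ).2.1
        exact absurd hpS (not_le.2 (hexp i J hJ _ hJP le_rfl h2 S hS hSm hDS))

/-! ### Existence for arbitrary real endpoints -/

theorem IsPiece.diff_Ioo {A : Set ℝ} (hA : IsPiece A) (a b : ℝ) : IsPiece (A \ Ioo a b) := by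
  obtain ⟨h, G, hG, hc, rfl⟩ := hA
  refine ⟨sdiff_subset.trans h, (fun J => J ∩ Iic a) '' G ∪ (fun J => J ∩ Ici b) '' G,
    (hG.image _).union (hG.image _), ?_, ?_⟩
  · rintro _ (⟨J, hJ, rfl⟩ | ⟨J, hJ, rfl⟩)
    · exact (hc J hJ).inter ordConnected_Iic
    · exact (hc J hJ).inter ordConnected_Ici
  · ext t
    simp only [mem_sdiff, mem_sUnion, mem_Ioo, mem_union, mem_image, not_and_or, not_lt]
    constructor
    · rintro ⟨⟨J, hJ, ht⟩, h | h⟩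
      · exact ⟨_, .inl ⟨J, hJ, rfl⟩, ht, h⟩
      · exact ⟨_, .inr ⟨J, hJ, rfl⟩, ht, h⟩
    · rintro ⟨_, ⟨J, hJ, rfl⟩ | ⟨J, hJ, rfl⟩, ht, h⟩
      · exact ⟨⟨J, hJ, ht⟩, .inl h⟩
      · exact ⟨⟨J, hJ, ht⟩, .inr h⟩

theorem isPiece_of_ordConnected {A : Set ℝ} (h : A ⊆ cake) (hA : A.OrdConnected) : IsPiece A :=
  ⟨h, {A}, finite_singleton _, by simpa using hA, by simp⟩

theorem exists_separation {E : Set ℝ} (hE : E.Finite) :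
    ∃ δ > 0, ∀ e ∈ E, ∀ e' ∈ E, e < e' → e + δ < e' := by
  have hfin : ((fun z : ℝ × ℝ => z.2 - z.1) '' {z ∈ E ×ˢ E | z.1 < z.2}).Finite :=
    ((hE.prod hE).subset (sep_subset _ _)).image _
  rcases (((fun z : ℝ × ℝ => z.2 - z.1) '' {z ∈ E ×ˢ E | z.1 < z.2})).eq_empty_or_nonempty
    with h | h
  · refine ⟨1, one_pos, fun e he e' he' hlt => ?_⟩
    exact absurd (h ▸ ⟨(e, e'), ⟨⟨he, he'⟩, hlt⟩, rfl⟩ : e' - e ∈ (∅ : Set ℝ)) (notMem_empty _)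
  · obtain ⟨d, ⟨⟨e₀, e₁⟩, ⟨-, hlt⟩, hd⟩, hmin⟩ := exists_min_image _ id hfin h
    simp only at hlt hd
    refine ⟨d / 2, by linarith, fun e he e' he' hlt' => ?_⟩
    have : d ≤ e' - e := hmin (e' - e) ⟨(e, e'), ⟨⟨he, he'⟩, hlt'⟩, rfl⟩
    linarith

theorem exists_isCAEI {n : ℕ} (hn : 0 < n) (D : Fin n → Set ℝ) (hD : ∀ i, IsDemand (D i)) :
    ∃ (p : ℝ → ℝ) (x : Fin n → Set ℝ), IsCAEI D p x := by
  classical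
  choose F hFfin hF hDF using hD
  set E : Set ℝ := ⋃ i, (Prod.fst '' F i ∪ Prod.snd '' F i) with hEdef
  obtain ⟨δ, hδ, hsep⟩ := exists_separation (E := E)
    (finite_iUnion fun i => ((hFfin i).image _).union ((hFfin i).image _))
  have hE : ∀ i, ∀ J ∈ F i, J.1 ∈ E ∧ J.2 ∈ E := fun i J hJ =>
    ⟨mem_iUnion.2 ⟨i, .inl ⟨J, hJ, rfl⟩⟩, mem_iUnion.2 ⟨i, .inr ⟨J, hJ, rfl⟩⟩⟩
  let o : Fin n := ⟨0, hn⟩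
  -- One left endpoint for each agent; `owns i` says that agent `i` is the first one with its point.
  let l : Fin n → ℝ := fun i => if h : (F i).Nonempty then h.choose.1 else 0
  have hl : ∀ i, (F i).Nonempty → ∃ J ∈ F i, J.1 = l i := fun i h =>
    ⟨h.choose, h.choose_spec, by simp [l, h]⟩
  let owns : Fin n → Prop := fun i =>
    i ≠ o ∧ (F i).Nonempty ∧ ∀ j < i, j ≠ o → (F j).Nonempty → l j ≠ l i
  have hle : ∀ i j, owns i → owns j → l i = l j → i = j := fun i j hi hj h => by
    rcases lt_trichotomy i j with hij | hij | hij
    · exact absurd h (hj.2.2 i hij hi.1 hi.2.1)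
    · exact hij
    · exact absurd h.symm (hi.2.2 j hij hj.1 hj.2.1)
  have hlE : ∀ i, owns i → l i ∈ E := fun i hi => by
    obtain ⟨J, hJ, h⟩ := hl i hi.2.1
    exact h ▸ (hE i J hJ).1
  let P : Set ℝ := l '' {i | owns i}
  let x : Fin n → Set ℝ := fun i => if i = o then cake \ ⋃ q ∈ P, Ioo q (q + δ) else
    if owns i then Ioo (l i) (l i + δ) else ∅
  have hxown : ∀ i, owns i → x i = Ioo (l i) (l i + δ) := fun i hi => by simp [x, hi, hi.1]
  have hxn : ∀ i ≠ o, ¬ owns i → x i = ∅ := fun i hi h => by simp [x, hi, h]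
  have hxo : x o = cake \ ⋃ q ∈ P, Ioo q (q + δ) := by simp [x]
  refine ⟨fun t => if t ∈ ⋃ q ∈ P, Ioo q (q + δ) then δ⁻¹ else 1, x,
    isCAEI_of_atoms (o := o) hδ hDF hF hE hsep (P := P) ?_ ?_ ?_ hxo ?_ ?_ ?_ ?_ ?_ ?_⟩
  · rintro _ ⟨i, hi, rfl⟩
    exact ⟨i, hl i hi.2.1⟩
  · intro i hi hne
    -- The point of agent `i` is owned by the first agent that has the same point.
    obtain ⟨j, hj, hmin⟩ := exists_min_image {j | j ≠ o ∧ (F j).Nonempty ∧ l j = l i} id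
      (toFinite _) ⟨i, hi, hne, rfl⟩
    obtain ⟨J, hJ, hJl⟩ := hl i hne
    refine ⟨J, hJ, j, ⟨hj.1, hj.2.1, fun k hk hko hkn hkl => ?_⟩, hj.2.2.trans hJl.symm⟩
    exact absurd hk (not_lt.2 (hmin k ⟨hko, hkn, hkl.trans hj.2.2⟩))
  · intro i
    by_cases hi : i = o
    · rw [hi, hxo]
      have : ∀ Q : Set ℝ, Q.Finite → IsPiece (cake \ ⋃ q ∈ Q, Ioo q (q + δ)) := fun Q hQ => by
        induction Q, hQ using Set.Finite.induction_on with
        | empty => simpa using isPiece_of_ordConnected subset_rfl ordConnected_Icc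
        | @insert a s _ _ ih =>
          rw [biUnion_insert, union_comm, ← sdiff_sdiff]
          exact ih.diff_Ioo _ _
      exact this P (toFinite _)
    · by_cases h : owns i
      · rw [hxown i h]
        obtain ⟨J, hJ, hJl⟩ := hl i h.2.1
        have h1 := hF i J hJ
        have h2 := hsep _ (hE i J hJ).1 _ (hE i J hJ).2 h1.2.1
        rw [hJl] at h1 h2
        exact isPiece_of_ordConnected
          (fun t ht => ⟨by linarith [ht.1], by linarith [ht.2]⟩) ordConnected_Ioo
      · rw [hxn i hi h]
        exact isPiece_of_ordConnected (empty_subset _) ordConnected_empty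
  · intro i hi
    by_cases h : owns i
    · exact .inr ⟨_, mem_image_of_mem l h, hxown i h⟩
    · exact .inl (hxn i hi h)
  · intro i j hij hi hj
    by_cases h : owns i
    swap
    · rw [hxn i hi h]; exact empty_disjoint _
    by_cases h' : owns j
    swap
    · rw [hxn j hj h']; exact disjoint_empty _
    rw [hxown i h, hxown j h', disjoint_left]
    intro t ht ht'
    rcases lt_trichotomy (l i) (l j) with hlt | heq | hlt
    · linarith [hsep _ (hlE i h) _ (hlE j h') hlt, ht.2, ht'.1]
    · exact hij (hle i j h h' heq)
    · linarith [hsep _ (hlE j h') _ (hlE i h) hlt, ht'.2, ht.1]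
  · rintro _ ⟨i, hi, rfl⟩
    exact ⟨i, hi.1, hxown i hi⟩
  · refine Measurable.ite (IsOpen.measurableSet ?_) measurable_const measurable_const
    exact isOpen_biUnion fun q _ => isOpen_Ioo
  · intro q hq t ht
    exact if_pos (mem_biUnion hq ht)
  · intro t ht
    rw [hxo] at ht
    rw [if_neg ht.2]
    exact ⟨one_pos, le_rfl⟩

/-! ### The parser reads the instance -/

/-- The numbers in the encoding of a list of intervals, as the parser stores them. -/
def numbers (L : List (Frac × Frac)) : List (List Bool) :=
  (L.flatMap fun J => [J.1.num.bits.reverse, J.1.den.bits.reverse, J.2.num.bits.reverse,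
    J.2.den.bits.reverse]).reverse

theorem foldl_parseStep_nat (k : ℕ) (i : Bool) (cnt : List Unit) (nums : List (List Bool))
    (out : List (List (List Bool))) :
    (encodeNat k).foldl parseStep (i, () :: cnt, [], nums, out) =
      (i, cnt, [], k.bits.reverse :: nums, out) := by
  have h : ∀ l cur : List Bool, (l.map Sym.bit).foldl parseStep (i, () :: cnt, cur, nums, out) =
      (i, () :: cnt, l.reverse ++ cur, nums, out) := fun l => by
    induction l with
    | nil => exact fun _ => rfl
    | cons b l ih =>
      intro cur
      refine (ih (b :: cur)).trans ?_
      simp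
  rw [encodeNat, List.foldl_append, h, List.append_nil]
  rfl

theorem foldl_parseStep_intervals (L : List (Frac × Frac)) (nums : List (List Bool))
    (out : List (List (List Bool))) :
    (encodeList encodeInterval L).foldl parseStep (true, [], [], nums, out) =
      (false, [], [], [], (numbers L ++ nums) :: out) := by
  induction L generalizing nums with
  | nil => rfl
  | cons J L ih =>
    have h1 : encodeList encodeInterval (J :: L) =
        Sym.item :: (encodeInterval J ++ encodeList encodeInterval L) := by simp [encodeList]
    have h2 : parseStep (true, [], [], nums, out) .item = (true, [(), (), (), ()], [], nums, out) :=
      rfl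
    rw [h1, List.foldl_cons, h2, List.foldl_append, encodeInterval, encodeFrac, encodeFrac,
      List.foldl_append, List.foldl_append, List.foldl_append, foldl_parseStep_nat,
      foldl_parseStep_nat, foldl_parseStep_nat, foldl_parseStep_nat, ih]
    simp [numbers]

theorem parse_encodeInstance (I : Instance) :
    parse (encodeInstance I) = I.demands.map numbers := by
  have h : ∀ (L : List (List (Frac × Frac))) (out : List (List (List Bool))),
      (encodeList (encodeList encodeInterval) L).foldl parseStep (false, [], [], [], out) =
        (false, [], [], [], (L.map numbers).reverse ++ out) := fun L => by
    induction L with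
    | nil => exact fun _ => rfl
    | cons l L ih =>
      intro out
      have h1 : encodeList (encodeList encodeInterval) (l :: L) =
          Sym.item :: (encodeList encodeInterval l ++ encodeList (encodeList encodeInterval) L) := by
        simp [encodeList]
      have h2 : parseStep (false, [], [], [], out) .item = (true, [], [], [], out) := rfl
      rw [h1, List.foldl_cons, h2, List.foldl_append, foldl_parseStep_intervals, ih]
      simp
  rw [parse, encodeInstance, h]
  simp

theorem firstPoint_numbers (L : List (Frac × Frac)) :
    firstPoint (numbers L) = L.head?.map Prod.fst := by
  rcases L with _ | ⟨⟨⟨a, b, hb⟩, q⟩, L⟩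
  · rfl
  · simp [firstPoint, numbers, appendBits_reverse, ofBits_bits, mkFrac, hb.ne']

theorem owned_encodeInstance (I : Instance) : owned (encodeInstance I) =
    dedupPoints (I.demands.tail.map fun L => L.head?.map Prod.fst) := by
  rw [owned, parse_encodeInstance, List.map_map, ← List.map_tail]
  congr 2
  funext L
  exact firstPoint_numbers L

/-! ### Correctness of the operations on fractions -/

theorem Frac.val_nonneg (q : Frac) : 0 ≤ q.val := by unfold Frac.val; positivity

theorem Frac.lt_iff {p q : Frac} : p.lt q = true ↔ p.val < q.val := by
  have hp : (0 : ℝ) < p.den := Nat.cast_pos.2 p.den_pos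
  have hq : (0 : ℝ) < q.den := Nat.cast_pos.2 q.den_pos
  rw [Frac.lt, decide_eq_true_iff, Frac.val, Frac.val, div_lt_div_iff₀ hp hq]
  exact_mod_cast Iff.rfl

theorem Frac.same_iff {p q : Frac} : p.same q = true ↔ p.val = q.val := by
  rw [Frac.same, Bool.and_eq_true, Bool.not_eq_true', Bool.not_eq_true', ← Bool.not_eq_true,
    ← Bool.not_eq_true, lt_iff, lt_iff, not_lt, not_lt, ← le_antisymm_iff, eq_comm]

theorem val_mkFrac {a b : ℕ} (hb : 0 < b) : (mkFrac a b).val = a / b := by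
  rw [mkFrac, dif_neg hb.ne']; rfl

theorem Frac.val_shift (q : Frac) {N : ℕ} (hN : 0 < N) : (q.shift N).val = q.val + (N : ℝ)⁻¹ := by
  have hq : (0 : ℝ) < q.den := Nat.cast_pos.2 q.den_pos
  have hN' : (0 : ℝ) < N := Nat.cast_pos.2 hN
  rw [Frac.shift, val_mkFrac (Nat.mul_pos q.den_pos hN), Frac.val]
  push_cast
  field_simp

theorem minPoint_spec (c : Frac → Bool) (l : List Frac) : (minPoint c l).val ≤ 1 ∧
    (∀ q ∈ l, c q = true → (minPoint c l).val ≤ q.val) ∧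
    ((minPoint c l).val = 1 ∨ ∃ q ∈ l, c q = true ∧ (minPoint c l).val = q.val) := by
  unfold minPoint
  induction l using List.reverseRecOn with
  | nil => simp [Frac.val]
  | append_singleton l q ih =>
    rw [List.foldl_append, List.foldl_cons, List.foldl_nil]
    set m := List.foldl (fun m q => if (c q && q.lt m) = true then q else m) ⟨1, 1, one_pos⟩ l
    obtain ⟨h1, h2, h3⟩ := ih
    by_cases h : (c q && q.lt m) = true
    · rw [if_pos h]
      rw [Bool.and_eq_true, Frac.lt_iff] at h
      refine ⟨h.2.le.trans h1, fun r hr hc => ?_, .inr ⟨q, by simp, h.1, rfl⟩⟩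
      rcases List.mem_append.1 hr with hr | hr
      · exact h.2.le.trans (h2 r hr hc)
      · rw [List.mem_singleton.1 hr]
    · rw [if_neg h]
      rw [Bool.and_eq_true, Frac.lt_iff, not_and, not_lt] at h
      refine ⟨h1, fun r hr hc => ?_, h3.imp_right fun ⟨r, hr, h⟩ =>
        ⟨r, List.mem_append_left _ hr, h⟩⟩
      rcases List.mem_append.1 hr with hr | hr
      · exact h2 r hr hc
      · rw [List.mem_singleton.1 hr] at hc ⊢
        exact h hc

/-- Two list entries do not denote the same point. -/
def DistinctPoints (o o' : Option Frac) : Prop := ∀ q ∈ o, ∀ r ∈ o', q.val ≠ r.val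

theorem any_isPoint_iff {l : List (Option Frac)} {q : Frac} :
    l.any (isPoint q) = true ↔ ∃ r, some r ∈ l ∧ q.val = r.val := by
  rw [List.any_eq_true]
  constructor
  · rintro ⟨_ | r, hr, h⟩
    · simp [isPoint] at h
    · exact ⟨r, hr, Frac.same_iff.1 h⟩
  · rintro ⟨r, hr, h⟩
    exact ⟨some r, hr, Frac.same_iff.2 h⟩

theorem addPoint_spec (l : List (Option Frac)) (o : Option Frac) : ∃ o', addPoint l o = o' :: l ∧
    (o' = none ∨ o' = o) ∧ (∀ o'' ∈ l, DistinctPoints o' o'') ∧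
    ∀ q ∈ o, ∃ r, some r ∈ o' :: l ∧ q.val = r.val := by
  refine ⟨_, rfl, ?_⟩
  rcases o with _ | q
  · simp [DistinctPoints]
  · dsimp only
    by_cases h : l.any (isPoint q) = true
    · rw [if_pos h]
      obtain ⟨r, hr, e⟩ := any_isPoint_iff.1 h
      refine ⟨.inl rfl, by simp [DistinctPoints], fun q' hq' => ⟨r, List.mem_cons_of_mem _ hr, ?_⟩⟩
      rw [← Option.mem_some_iff.1 hq']
      exact e
    · rw [if_neg h]
      refine ⟨.inr rfl, fun o'' ho'' q' hq' r hr e => h (any_isPoint_iff.2 ⟨r, ?_, ?_⟩),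
        fun q' hq' => ⟨q, by simp, ?_⟩⟩
      · rwa [← Option.mem_def.1 hr]
      · rw [← Option.mem_some_iff.1 hq'] at e
        exact e
      · rw [Option.mem_some_iff.1 hq']

theorem foldl_addPoint_spec (l acc : List (Option Frac)) (hacc : acc.Pairwise DistinctPoints) :
    (l.foldl addPoint acc).length = acc.length + l.length ∧
    (l.foldl addPoint acc).Pairwise DistinctPoints ∧
    (∀ o ∈ acc, o ∈ l.foldl addPoint acc) ∧
    (∀ q, some q ∈ l.foldl addPoint acc → some q ∈ acc ∨ some q ∈ l) ∧
    ∀ q, some q ∈ l → ∃ r, some r ∈ l.foldl addPoint acc ∧ q.val = r.val := by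
  induction l generalizing acc with
  | nil => exact ⟨by simp, hacc, fun _ h => h, fun _ h => .inl h, by simp⟩
  | cons o l ih =>
    obtain ⟨o', h1, h2, h3, h4⟩ := addPoint_spec acc o
    obtain ⟨i1, i2, i3, i4, i5⟩ := ih (o' :: acc) (List.pairwise_cons.2 ⟨h3, hacc⟩)
    rw [List.foldl_cons, h1]
    refine ⟨by rw [i1]; simp; omega, i2, fun o ho => i3 o (List.mem_cons_of_mem _ ho),
      fun q hq => ?_, fun q hq => ?_⟩
    · rcases i4 q hq with h | h
      · rcases List.mem_cons.1 h with h | h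
        · rcases h2 with h2 | h2
          · rw [h2] at h; cases h
          · exact .inr (by rw [h, h2]; simp)
        · exact .inl h
      · exact .inr (List.mem_cons_of_mem _ h)
    · rcases List.mem_cons.1 hq with h | h
      · obtain ⟨r, hr, e⟩ := h4 q h.symm
        exact ⟨r, i3 _ hr, e⟩
      · exact i5 q h

theorem dedupPoints_spec (l : List (Option Frac)) : (dedupPoints l).length = l.length ∧
    (dedupPoints l).Pairwise DistinctPoints ∧
    (∀ q, some q ∈ dedupPoints l → some q ∈ l) ∧
    ∀ q, some q ∈ l → ∃ r, some r ∈ dedupPoints l ∧ q.val = r.val := by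
  obtain ⟨h1, h2, -, h4, h5⟩ := foldl_addPoint_spec l [] .nil
  refine ⟨by rw [dedupPoints, List.length_reverse, h1]; simp, ?_, fun q hq => ?_, fun q hq => ?_⟩
  · rw [dedupPoints, List.pairwise_reverse]
    exact h2.imp fun h q hq r hr e => h r hr q hq e.symm
  · rw [dedupPoints, List.mem_reverse] at hq
    exact (h4 q hq).resolve_left (by simp)
  · obtain ⟨r, hr, e⟩ := h5 q hq
    exact ⟨r, by rwa [dedupPoints, List.mem_reverse], e⟩

/-! ### The division of the cake by the algorithm -/

theorem measurableSet_toSet (P : PricedInterval) : MeasurableSet P.toSet := by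
  simp only [PricedInterval.toSet, measurableSet_setOfPred]
  fun_prop

theorem ordConnected_toSet (P : PricedInterval) : P.toSet.OrdConnected := by
  refine ⟨fun s hs t ht u hu => ⟨?_, ?_⟩⟩
  · rcases hs.1 with h | h
    · exact .inl (h.trans_le hu.1)
    · exact (h.2 ▸ hu.1 : P.left.val ≤ u).lt_or_eq.imp_right fun h' => ⟨h.1, h'.symm⟩
  · rcases ht.2 with h | h
    · exact .inl (hu.2.trans_lt h)
    · exact (h.2 ▸ hu.2 : u ≤ P.right.val).lt_or_eq.imp_right fun h' => ⟨h.1, h'⟩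

theorem isPiece_bundle {O : Output} {n : ℕ} {i : Fin n} (h : O.bundle n i ⊆ cake) :
    IsPiece (O.bundle n i) := by
  refine ⟨h, PricedInterval.toSet '' {P | P ∈ O.getD i.val []}, ?_, ?_, ?_⟩
  · exact (List.finite_toSet _).image _
  · rintro _ ⟨P, -, rfl⟩
    exact ordConnected_toSet P
  · rw [sUnion_image]; rfl

theorem toSet_closed (l r d : Frac) : PricedInterval.toSet ⟨l, r, true, true, d⟩ =
    Icc l.val r.val := by
  ext t
  simp [PricedInterval.toSet, le_iff_lt_or_eq, eq_comm]

theorem toSet_open (l r d : Frac) : PricedInterval.toSet ⟨l, r, false, false, d⟩ =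
    Ioo l.val r.val := by
  ext t
  simp [PricedInterval.toSet]

theorem iUnion_gaps {N : ℕ} (hN : 0 < N) (l : List Frac) :
    ⋃ P ∈ gaps N l, P.toSet = cake \ ⋃ q ∈ l, Ioo q.val (q.val + (N : ℝ)⁻¹) := by
  have hδ : 0 < (N : ℝ)⁻¹ := inv_pos.2 (Nat.cast_pos.2 hN)
  have h0 : (mkFrac 0 1).val = 0 := by rw [val_mkFrac one_pos]; simp
  obtain ⟨f1, f2, f3⟩ := minPoint_spec (fun _ => true) l
  ext t
  simp only [gaps, List.mem_cons, iUnion_iUnion_eq_or_left, List.mem_map, iUnion_exists,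
    biUnion_and', iUnion_iUnion_eq_right, mem_union, mem_iUnion, gapAfter, toSet_closed, h0,
    Frac.val_shift _ hN, mem_sdiff, not_exists, mem_Icc, mem_Ioo, not_and, not_lt, cake]
  constructor
  · rintro (h | ⟨q, hq, h⟩)
    · exact ⟨⟨h.1, h.2.trans f1⟩, fun r hr hrt =>
        absurd (h.2.trans (f2 r hr rfl)) (not_le.2 hrt)⟩
    · obtain ⟨g1, g2, -⟩ := minPoint_spec q.lt l
      refine ⟨⟨by linarith [q.val_nonneg, h.1], h.2.trans g1⟩, fun r hr hrt => ?_⟩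
      by_cases hqr : q.val < r.val
      · exact absurd (h.2.trans (g2 r hr (Frac.lt_iff.2 hqr))) (not_le.2 hrt)
      · linarith [h.1]
  · rintro ⟨⟨ht0, ht1⟩, ht⟩
    by_cases hex : ∃ q ∈ l, q.val < t
    · -- The gap that contains `t` starts at the last atom before `t`.
      obtain ⟨q, ⟨hq, hqt⟩, hmax⟩ := exists_max_image {q | q ∈ l ∧ q.val < t} Frac.val
        ((List.finite_toSet l).subset fun q hq => hq.1) hex
      obtain ⟨-, -, g3⟩ := minPoint_spec q.lt l
      refine .inr ⟨q, hq, ht q hq hqt, ?_⟩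
      rcases g3 with g3 | ⟨r, hr, hqr, g3⟩
      · rwa [g3]
      · rw [g3]
        by_contra! hrt
        exact absurd (Frac.lt_iff.1 hqr) (not_lt.2 (hmax r ⟨hr, hrt⟩))
    · push Not at hex
      refine .inl ⟨ht0, ?_⟩
      rcases f3 with f3 | ⟨r, hr, -, f3⟩
      · rwa [f3]
      · rw [f3]; exact hex r hr

theorem iUnion_atom {N : ℕ} (hN : 0 < N) (q : Frac) :
    ⋃ P ∈ atom N (some q), P.toSet = Ioo q.val (q.val + (N : ℝ)⁻¹) := by
  simp [atom, toSet_open, Frac.val_shift _ hN]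

/-! ### The price density of the algorithm -/

/-- The price density at `t` from the intervals of a list. -/
noncomputable def densityAt (t : ℝ) (L : List PricedInterval) : ℝ :=
  (L.map fun P => P.toSet.indicator (fun _ => P.density.val) t).sum

theorem densityAt_spec {t d : ℝ} (hd : 0 ≤ d) (L : List PricedInterval)
    (hL : ∀ P ∈ L, P.density.val = d) : 0 ≤ densityAt t L ∧ densityAt t L ≤ L.length * d ∧
      ((∃ P ∈ L, t ∈ P.toSet) → d ≤ densityAt t L) ∧
      ((∀ P ∈ L, t ∉ P.toSet) → densityAt t L = 0) := by
  induction L with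
  | nil => simp [densityAt]
  | cons P L ih =>
    obtain ⟨h1, h2, h3, h4⟩ := ih fun P hP => hL P (List.mem_cons_of_mem _ hP)
    have hP := hL P List.mem_cons_self
    have e : densityAt t (P :: L) =
        P.toSet.indicator (fun _ => P.density.val) t + densityAt t L := by simp [densityAt]
    rw [e, hP, List.length_cons]
    push_cast
    by_cases ht : t ∈ P.toSet
    · rw [indicator_of_mem ht]
      exact ⟨by linarith, by linarith, fun _ => by linarith,
        fun h => absurd ht (h P List.mem_cons_self)⟩
    · rw [indicator_of_notMem ht, zero_add]
      refine ⟨h1, by linarith, fun ⟨Q, hQ, hQt⟩ => h3 ?_,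
        fun h => h4 fun Q hQ => h Q (List.mem_cons_of_mem _ hQ)⟩
      rcases List.mem_cons.1 hQ with rfl | hQ
      · exact absurd hQt ht
      · exact ⟨Q, hQ, hQt⟩

theorem densityAt_atom {N : ℕ} (hN : 0 < N) (t : ℝ) (q : Frac) : densityAt t (atom N (some q)) =
    (Ioo q.val (q.val + (N : ℝ)⁻¹)).indicator (fun _ => (N : ℝ)) t := by
  simp [densityAt, atom, toSet_open, Frac.val_shift _ hN, val_mkFrac]

theorem price_cons (L : List PricedInterval) (O : List (List PricedInterval)) (t : ℝ) :
    Output.price (L :: O) t = densityAt t L + (O.map (densityAt t)).sum := by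
  have h : ∀ O : List (List PricedInterval), Output.price O t = (O.map (densityAt t)).sum :=
    fun O => by
      induction O with
      | nil => simp [Output.price]
      | cons L O ih =>
        rw [List.map_cons, List.sum_cons, ← ih]
        simp [Output.price, densityAt]
  rw [h, List.map_cons, List.sum_cons]

theorem measurable_price (O : Output) : Measurable O.price := by
  have h : ∀ L : List PricedInterval, Measurable fun t : ℝ =>
      (L.map fun P => P.toSet.indicator (fun _ => P.density.val) t).sum := fun L => by
    induction L with
    | nil => simp
    | cons P L ih =>
      simp only [List.map_cons, List.sum_cons]
      exact (measurable_const.indicator (measurableSet_toSet P)).add ih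
  exact h O.flatten

/-- If at most one entry of a list has a nonzero value, then that value is the sum. -/
theorem sum_map_eq_of_pairwise {α : Type} (f : α → ℝ) (l : List α)
    (h : l.Pairwise fun a b => f a = 0 ∨ f b = 0) {a : α} (ha : a ∈ l) (hfa : f a ≠ 0) :
    (l.map f).sum = f a := by
  induction l with
  | nil => cases ha
  | cons b l ih =>
    obtain ⟨hb, hl⟩ := List.pairwise_cons.1 h
    rw [List.map_cons, List.sum_cons]
    by_cases hfb : f b = 0
    · rcases List.mem_cons.1 ha with rfl | ha
      · exact absurd hfb hfa
      · rw [hfb, zero_add, ih hl ha]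
    · have : (l.map f).sum = 0 := by
        refine List.sum_eq_zero fun y hy => ?_
        obtain ⟨c, hc, rfl⟩ := List.mem_map.1 hy
        exact (hb c hc).resolve_left hfb
      rw [this, add_zero]
      rcases List.mem_cons.1 ha with rfl | ha
      · rfl
      · exact absurd ((hb a ha).resolve_left hfb) hfa

/-! ### The size of the cells -/

theorem cells_eq (w : List Sym) : cells w = 4 ^ w.length := by
  have : ∀ n : ℕ, w.foldl (fun n _ => Nat.bit false (Nat.bit false n)) n = n * 4 ^ w.length := by
    induction w with
    | nil => simp
    | cons s w ih =>
      intro n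
      rw [List.foldl_cons, ih, List.length_cons, pow_succ]
      simp [Nat.bit]
      ring
  rw [cells, this, one_mul]

theorem length_le_encodeList {α : Type} (e : α → List Sym) (l : List α) :
    l.length ≤ (encodeList e l).length ∧ ∀ a ∈ l, (e a).length ≤ (encodeList e l).length := by
  induction l with
  | nil => simp
  | cons b l ih =>
    have h : encodeList e (b :: l) = Sym.item :: (e b ++ encodeList e l) := by simp [encodeList]
    rw [h, List.length_cons, List.length_cons, List.length_append]
    refine ⟨by omega, fun a ha => ?_⟩
    rcases List.mem_cons.1 ha with rfl | ha
    · omega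
    · have := ih.2 a ha
      omega

theorem den_lt_two_pow_encodeFrac (q : Frac) : q.den < 2 ^ (encodeFrac q).length := by
  refine Nat.size_le.1 ?_
  rw [← Nat.size_eq_bits_len]
  simp [encodeFrac, encodeNat]
  omega

/-- The denominators of an instance are small enough for the cells to separate the endpoints. -/
theorem den_lt_two_pow {I : Instance} {L : List (Frac × Frac)} (hL : L ∈ I.demands)
    {J : Frac × Frac} (hJ : J ∈ L) : J.1.den < 2 ^ (encodeInstance I).length ∧
      J.2.den < 2 ^ (encodeInstance I).length := by
  have h : (encodeInterval J).length ≤ (encodeInstance I).length :=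
    ((length_le_encodeList _ _).2 J hJ).trans ((length_le_encodeList _ _).2 L hL)
  rw [encodeInterval, List.length_append] at h
  exact ⟨(den_lt_two_pow_encodeFrac _).trans_le (Nat.pow_le_pow_right two_pos (by omega)),
    (den_lt_two_pow_encodeFrac _).trans_le (Nat.pow_le_pow_right two_pos (by omega))⟩

theorem add_inv_lt_of_den_lt {p q : Frac} {m : ℕ} (hp : p.den < 2 ^ m) (hq : q.den < 2 ^ m)
    (h : p.val < q.val) : p.val + ((4 ^ m : ℕ) : ℝ)⁻¹ < q.val := by
  have hp0 : (0 : ℝ) < p.den := Nat.cast_pos.2 p.den_pos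
  have hq0 : (0 : ℝ) < q.den := Nat.cast_pos.2 q.den_pos
  have h1 : p.num * q.den + 1 ≤ q.num * p.den := by
    rw [Frac.val, Frac.val, div_lt_div_iff₀ hp0 hq0] at h
    exact_mod_cast h
  have h2 : p.den * q.den < 4 ^ m := by
    rw [show 4 = 2 * 2 from rfl, mul_pow]
    exact Nat.mul_lt_mul_of_lt_of_lt hp hq
  have h1' : (p.num : ℝ) * q.den + 1 ≤ q.num * p.den := by exact_mod_cast h1
  have h2' : (p.den : ℝ) * q.den < ((4 ^ m : ℕ) : ℝ) := by exact_mod_cast h2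
  have h3 : ((4 ^ m : ℕ) : ℝ)⁻¹ < ((p.den : ℝ) * q.den)⁻¹ := inv_strictAnti₀ (by positivity) h2'
  have h4 : p.val + ((p.den : ℝ) * q.den)⁻¹ ≤ q.val := by
    have e1 : p.val + ((p.den : ℝ) * q.den)⁻¹ = (p.num * q.den + 1) / (p.den * q.den) := by
      rw [Frac.val]; field_simp
    have e2 : q.val = (q.num * p.den) / (p.den * q.den) := by
      rw [Frac.val]; field_simp
    rw [e1, e2]
    exact div_le_div_of_nonneg_right h1' (by positivity)
  linarith

/-! ### Correctness of the algorithm -/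

theorem length_solution (I : Instance) : (solution I).length = I.agents := by
  rw [solution, solve, List.length_cons, List.length_map, owned_encodeInstance,
    (dedupPoints_spec _).1, List.length_map, List.length_tail, Instance.agents]
  have := List.length_pos_iff.2 I.ne_nil
  omega

theorem isCAEI_solution (I : Instance) : IsCAEI I.demand (Output.price (solution I))
    (Output.bundle (solution I) I.agents) := by
  have hagents : 0 < I.agents := List.length_pos_iff.2 I.ne_nil
  set m := (encodeInstance I).length with hm
  set N : ℕ := 4 ^ m with hNdef
  have hN : 0 < N := by positivity
  have hN0 : (0 : ℝ) < N := Nat.cast_pos.2 hN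
  set W : List (Option Frac) := owned (encodeInstance I) with hW
  set l : List Frac := W.flatMap Option.toList with hl
  have hmem : ∀ q, q ∈ l ↔ some q ∈ W := fun q => by
    simp [hl, List.mem_flatMap]
  have hsol : solution I = gaps N l :: W.map (atom N) := by
    rw [solution, solve, cells_eq]
  obtain ⟨w1, w2, w3, w4⟩ := dedupPoints_spec (I.demands.tail.map fun L => L.head?.map Prod.fst)
  rw [← owned_encodeInstance, ← hW] at w1 w2 w3 w4
  have hWlen : W.length + 1 = I.agents := by
    rw [w1, List.length_map, List.length_tail]
    exact Nat.sub_add_cancel hagents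
  set E : Set ℝ := {e | ∃ L ∈ I.demands, ∃ J ∈ L, e = J.1.val ∨ e = J.2.val} with hE
  have hsep : ∀ e ∈ E, ∀ e' ∈ E, e < e' → e + (N : ℝ)⁻¹ < e' := by
    have hden : ∀ e ∈ E, ∃ q : Frac, q.den < 2 ^ m ∧ e = q.val := by
      rintro e ⟨L, hL, J, hJ, rfl | rfl⟩
      · exact ⟨_, (den_lt_two_pow hL hJ).1, rfl⟩
      · exact ⟨_, (den_lt_two_pow hL hJ).2, rfl⟩
    intro e he e' he' h
    obtain ⟨p, hp, rfl⟩ := hden e he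
    obtain ⟨q, hq, rfl⟩ := hden e' he'
    exact add_inv_lt_of_den_lt hp hq h
  have hWpt : ∀ q, some q ∈ W → ∃ L ∈ I.demands, ∃ J ∈ L, J.1 = q := fun q hq => by
    obtain ⟨L, hL, h⟩ := List.mem_map.1 (w3 q hq)
    obtain ⟨J, hJ, h⟩ := Option.map_eq_some_iff.1 h
    exact ⟨L, List.mem_of_mem_tail hL, J, List.mem_of_mem_head? hJ, h⟩
  have hWE : ∀ q, some q ∈ W → q.val ∈ E := fun q hq => by
    obtain ⟨L, hL, J, hJ, rfl⟩ := hWpt q hq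
    exact ⟨L, hL, J, hJ, .inl rfl⟩
  -- Atoms at distinct points are disjoint.
  have hdisj : ∀ q, some q ∈ W → ∀ r, some r ∈ W → q.val ≠ r.val →
      Disjoint (Ioo q.val (q.val + (N : ℝ)⁻¹)) (Ioo r.val (r.val + (N : ℝ)⁻¹)) := by
    intro q hq r hr hne
    rw [disjoint_left]
    intro t ht ht'
    rcases hne.lt_or_gt with hlt | hlt
    · linarith [hsep _ (hWE q hq) _ (hWE r hr) hlt, ht.2, ht'.1]
    · linarith [hsep _ (hWE r hr) _ (hWE q hq) hlt, ht'.2, ht.1]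
  let o : Fin I.agents := ⟨0, hagents⟩
  have hbo : Output.bundle (solution I) I.agents o =
      cake \ ⋃ q ∈ Frac.val '' {q | q ∈ l}, Ioo q (q + (N : ℝ)⁻¹) := by
    rw [biUnion_image, hsol]
    exact iUnion_gaps hN l
  have hb : ∀ (j : ℕ) (hj : j < W.length) (hj' : j + 1 < I.agents),
      Output.bundle (solution I) I.agents ⟨j + 1, hj'⟩ = ⋃ P ∈ atom N W[j], P.toSet := by
    intro j hj hj'
    rw [hsol, Output.bundle, List.getD_cons_succ, List.getD_eq_getElem _ _ (by simpa using hj),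
      List.getElem_map]
  have hcases : ∀ i ≠ o, ∃ (j : ℕ) (hj : j < W.length) (hj' : j + 1 < I.agents),
      i = ⟨j + 1, hj'⟩ := by
    rintro ⟨_ | j, hj⟩ hi
    · exact absurd rfl hi
    · exact ⟨j, by omega, hj, rfl⟩
  have hbx : ∀ i ≠ o, ∃ (j : ℕ) (hj : j < W.length), i.val = j + 1 ∧
      (W[j] = none ∧ Output.bundle (solution I) I.agents i = ∅ ∨ ∃ q, W[j] = some q ∧
        Output.bundle (solution I) I.agents i = Ioo q.val (q.val + (N : ℝ)⁻¹)) := by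
    intro i hi
    obtain ⟨j, hj, hj', rfl⟩ := hcases i hi
    refine ⟨j, hj, rfl, ?_⟩
    rw [hb j hj hj']
    rcases W[j] with _ | q
    · exact .inl ⟨rfl, by simp [atom]⟩
    · exact .inr ⟨q, rfl, iUnion_atom hN q⟩
  have hatomcake : ∀ q, some q ∈ W → Ioo q.val (q.val + (N : ℝ)⁻¹) ⊆ cake := by
    intro q hq t ht
    obtain ⟨L, hL, J, hJ, rfl⟩ := hWpt q hq
    have h1 := I.valid L hL J hJ
    have h2 := hsep _ ⟨L, hL, J, hJ, .inl rfl⟩ _ ⟨L, hL, J, hJ, .inr rfl⟩ h1.1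
    exact ⟨J.1.val_nonneg.trans ht.1.le, by linarith [ht.2]⟩
  have hprice : ∀ t, Output.price (solution I) t =
      densityAt t (gaps N l) + (W.map fun o => densityAt t (atom N o)).sum := fun t => by
    rw [hsol, price_cons, List.map_map]; rfl
  have hgapden : ∀ P ∈ gaps N l, P.density.val = (N : ℝ)⁻¹ := by
    have : (mkFrac 1 N).val = (N : ℝ)⁻¹ := by rw [val_mkFrac hN]; simp
    intro P hP
    rcases List.mem_cons.1 hP with rfl | hP
    · exact this
    · obtain ⟨q, -, rfl⟩ := List.mem_map.1 hP
      exact this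
  refine isCAEI_of_atoms (o := o) (P := Frac.val '' {q | q ∈ l}) (E := E) (δ := (N : ℝ)⁻¹)
    (F := fun i => (fun J : Frac × Frac => (J.1.val, J.2.val)) '' {J | J ∈ I.demands.get i})
    (inv_pos.2 hN0) ?_ ?_ ?_ hsep ?_ ?_ ?_ hbo ?_ ?_ ?_ (measurable_price _) ?_ ?_
  · intro i
    rw [biUnion_image]
    rfl
  · rintro i _ ⟨J, hJ, rfl⟩
    exact ⟨J.1.val_nonneg, I.valid _ (List.get_mem _ _) J hJ⟩
  · rintro i _ ⟨J, hJ, rfl⟩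
    exact ⟨⟨_, List.get_mem _ i, J, hJ, .inl rfl⟩, ⟨_, List.get_mem _ i, J, hJ, .inr rfl⟩⟩
  · rintro _ ⟨q, hq, rfl⟩
    obtain ⟨L, hL, J, hJ, rfl⟩ := hWpt q ((hmem q).1 hq)
    obtain ⟨i, rfl⟩ := List.get_of_mem hL
    exact ⟨i, _, ⟨J, hJ, rfl⟩, rfl⟩
  · rintro i hi ⟨_, J, hJ, -⟩
    obtain ⟨j, hj, hj', rfl⟩ := hcases i hi
    obtain ⟨K, T, hK⟩ := List.exists_cons_of_ne_nil (List.ne_nil_of_mem hJ)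
    have hmt : I.demands.get ⟨j + 1, hj'⟩ ∈ I.demands.tail := by
      rw [List.mem_iff_getElem]
      refine ⟨j, by rw [List.length_tail]; exact Nat.lt_sub_of_add_lt hj', ?_⟩
      rw [List.getElem_tail]
      rfl
    obtain ⟨r, hr, e⟩ := w4 K.1 (List.mem_map.2 ⟨_, hmt,
      (congrArg (fun L => (List.head? L).map Prod.fst) hK).trans rfl⟩)
    refine ⟨_, ⟨K, ?_, rfl⟩, r, (hmem r).2 hr, e.symm⟩
    exact (congrArg (K ∈ ·) hK).mpr List.mem_cons_self
  · intro i
    refine isPiece_bundle ?_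
    by_cases hi : i = o
    · rw [hi, hbo]
      exact sdiff_subset
    · obtain ⟨j, hj, -, h | ⟨q, hq, h⟩⟩ := hbx i hi
      · rw [h.2]; exact empty_subset _
      · rw [h]; exact hatomcake q (hq ▸ List.getElem_mem hj)
  · intro i hi
    obtain ⟨j, hj, -, h | ⟨q, hq, h⟩⟩ := hbx i hi
    · exact .inl h.2
    · exact .inr ⟨q.val, mem_image_of_mem _ ((hmem q).2 (hq ▸ List.getElem_mem hj)), h⟩
  · intro i i' hii hi hi'
    obtain ⟨j, hj, e, h | ⟨q, hq, h⟩⟩ := hbx i hi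
    · rw [h.2]; exact empty_disjoint _
    obtain ⟨j', hj', e', h' | ⟨r, hr, h'⟩⟩ := hbx i' hi'
    · rw [h'.2]; exact disjoint_empty _
    rw [h, h']
    refine hdisj q (hq ▸ List.getElem_mem hj) r (hr ▸ List.getElem_mem hj') fun hqr => ?_
    have hjj : j ≠ j' := fun hjj => hii (Fin.ext (by omega))
    rcases hjj.lt_or_gt with hlt | hlt
    · exact List.pairwise_iff_getElem.1 w2 j j' hj hj' hlt q hq r hr hqr
    · exact List.pairwise_iff_getElem.1 w2 j' j hj' hj hlt r hr q hq hqr.symm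
  · rintro _ ⟨q, hq, rfl⟩
    obtain ⟨j, hj, e⟩ := List.mem_iff_getElem.1 ((hmem q).1 hq)
    have hj' : j + 1 < I.agents := hWlen ▸ Nat.succ_lt_succ hj
    refine ⟨⟨j + 1, hj'⟩, fun h => ?_, ?_⟩
    · exact absurd (congrArg Fin.val h) (Nat.succ_ne_zero j)
    · refine (hb j hj hj').trans ?_
      rw [e]
      exact iUnion_atom hN q
  · -- On an atom, the price density is `N`.
    rintro _ ⟨q, hq, rfl⟩ t ht
    have hqW := (hmem q).1 hq
    have hg : ∀ P ∈ gaps N l, t ∉ P.toSet := fun P hP htP => by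
      have : t ∈ ⋃ P ∈ gaps N l, P.toSet := mem_biUnion (x := P) hP htP
      rw [iUnion_gaps hN] at this
      exact this.2 (mem_biUnion (x := q) hq ht)
    have hqt : densityAt t (atom N (some q)) = N := by
      rw [densityAt_atom hN, indicator_of_mem ht]
    rw [hprice, (densityAt_spec (inv_pos.2 hN0).le _ hgapden).2.2.2 hg, zero_add,
      sum_map_eq_of_pairwise _ W ?_ hqW (by rw [hqt]; exact hN0.ne'), hqt, inv_inv]
    refine w2.imp_of_mem fun {a b} ha hb hab => ?_
    rcases a with _ | q
    · exact .inl (by simp [densityAt, atom])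
    rcases b with _ | r
    · exact .inr (by simp [densityAt, atom])
    rw [densityAt_atom hN, densityAt_atom hN]
    by_cases h : t ∈ Ioo q.val (q.val + (N : ℝ)⁻¹)
    · exact .inr (indicator_of_notMem
        (disjoint_left.1 (hdisj q ha r hb (hab q rfl r rfl)) h) _)
    · exact .inl (indicator_of_notMem h _)
  · -- Outside of the atoms, it is positive, and at most `1` because there are at most `N` gaps.
    intro t ht
    have hatoms : (W.map fun o => densityAt t (atom N o)).sum = 0 := by
      refine List.sum_eq_zero fun y hy => ?_
      obtain ⟨_ | q, hq, rfl⟩ := List.mem_map.1 hy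
      · simp [densityAt, atom]
      · rw [densityAt_atom hN]
        rw [hbo, biUnion_image] at ht
        exact indicator_of_notMem (fun h => ht.2 (mem_biUnion (x := q) ((hmem q).2 hq) h)) _
    have hgt : ∃ P ∈ gaps N l, t ∈ P.toSet := by
      rw [hsol] at ht
      simpa [Output.bundle, o] using ht
    obtain ⟨-, h2, h3, -⟩ := densityAt_spec (t := t) (inv_pos.2 hN0).le _ hgapden
    rw [hprice, hatoms, add_zero]
    refine ⟨(inv_pos.2 hN0).trans_le (h3 hgt), h2.trans ?_⟩
    have hlen : (gaps N l).length ≤ N := by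
      have h1 : l.length ≤ W.length := by
        rw [hl]
        clear_value W
        clear * -
        induction W with
        | nil => simp
        | cons o W ih => rcases o with _ | q <;> simp at ih ⊢ <;> omega
      have h2 : I.agents ≤ m := (length_le_encodeList _ _).1
      have h3 : m < N := Nat.lt_pow_self (by omega)
      rw [gaps, List.length_cons, List.length_map]
      omega
    rw [← div_eq_mul_inv, div_le_one hN0]
    exact_mod_cast hlen

end CakeCutting

theorem mainTheorem3 :
    (∀ n : ℕ, 0 < n → ∀ D : Fin n → Set ℝ, (∀ i, CakeCutting.IsDemand (D i)) →
      ∃ (p : ℝ → ℝ) (x : Fin n → Set ℝ), CakeCutting.IsCAEI D p x) ∧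
    (∃ f : CakeCutting.Instance → CakeCutting.Output,
      Nonempty (Turing.TM2ComputableInPolyTime
        CakeCutting.encodeInstance CakeCutting.encodeOutput f) ∧
      ∀ I : CakeCutting.Instance, (f I).length = I.agents ∧
        CakeCutting.IsCAEI I.demand (CakeCutting.Output.price (f I))
          (CakeCutting.Output.bundle (f I) I.agents)) :=
  ⟨fun _ hn D hD => CakeCutting.exists_isCAEI hn D hD, CakeCutting.solution,
    CakeCutting.computableInPolyTime_solution, fun I =>
      ⟨CakeCutting.length_solution I, CakeCutting.isCAEI_solution I⟩⟩
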